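/- A leader contributor system consists of a finite data domain $D$ with an initial value $a^0\in D$ and two finite automata, the leader $P_L=(Q_L,q_L^0,\delta_L)$ and the contributor $P_C=(Q_C,q_C^0,\delta_C)$, whose transitions are labelled by $!a$ (write $a$), $?a$ (read $a$), for $a\in D$, or $\varepsilon$ (internal). A configuration with $t\in\mathbb{N}$ contributors is a triple $(q,a,pc)\in Q_L\times D\times Q_C^t$; it is initial if $q=q_L^0$, $a=a^0$ and $pc(i)=q_C^0$ for all $i$. In one step, either the leader or exactly one contributor takes a transition of its automaton: $!b$ replaces the memory value by $b$, $?b$ requires the memory value to be $b$ and leaves it unchanged, and $\varepsilon$ leaves it unchanged. The problem leader contributor reachability (LCR) asks, given such a system and a set $F\subseteq Q_L$ of final states, whether for some number $t$ of contributors there is a finite computation from the initial configuration with $t$ contributors to a configuration whose leader state is in $F$. Theorem 3. Let $L=|Q_L|$ and $D$ also denote the size of the data domain. LCR, parameterized by $L$ and $D$, can be decided by a deterministic algorithm in time $(L+D)^{\mathcal{O}(L+D)}$, up to a factor polynomial in the size of the input: there are a single algorithm and constants $c,k\in\mathbb{N}$ such that on every input of size $n$ the algorithm halts with the correct answer after at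 most $(L+D)^{c\,(L+D)}\cdot n^{k}$ steps. -/

import Mathlib

/-! ## Leader contributor systems -/

/-- The memory operations over a data domain `D`: writes and reads. -/
inductive MemOp (D : Type) : Type where
  | write (a : D) : MemOp D
  | read (a : D) : MemOp D

/-- A thread: an automaton over the alphabet of memory operations, with state set `Q`.
The label `none` stands for an internal (`ε`) transition. -/
structure Thread (D Q : Type) where
  /-- the initial state -/
  init : Q
  /-- the transition relation -/
  trans : Set (Q × Option (MemOp D) × Q)

/-- A leader contributor system with data domain `D`, leader states `QL` and contributor
states `QC`. -/
structure LCSystem (D QL QC : Type) where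
  /-- the initial memory value -/
  initVal : D
  /-- the leader -/
  leader : Thread D QL
  /-- the contributor -/
  contributor : Thread D QC

/-- `MemStep o a a'`: an operation labelled `o` may be performed when the memory holds `a`, and
afterwards the memory holds `a'`. -/
inductive MemStep {D : Type} : Option (MemOp D) → D → D → Prop where
  | eps (a : D) : MemStep none a a
  | read (a : D) : MemStep (some (MemOp.read a)) a a
  | write (a b : D) : MemStep (some (MemOp.write b)) a b

/-- A configuration with `t` contributors. -/
structure Config (D QL QC : Type) (t : ℕ) where
  /-- the state of the leader -/
  leader : QL
  /-- the memory value -/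
  mem : D
  /-- the states of the contributors -/
  pc : Fin t → QC

namespace LCSystem

variable {D QL QC : Type}

/-- The labelled transition relation between configurations with the same number `t` of
contributors: one step of the leader, or one step of a single contributor. -/
inductive Step (S : LCSystem D QL QC) {t : ℕ} :
    Config D QL QC t → Option (MemOp D) → Config D QL QC t → Prop where
  | leader (q q' : QL) (a a' : D) (pc : Fin t → QC) (o : Option (MemOp D))
      (htrans : (q, o, q') ∈ S.leader.trans) (hmem : MemStep o a a') :
      Step S ⟨q, a, pc⟩ o ⟨q', a', pc⟩
  | contributor (q : QL) (a a' : D) (pc : Fin t → QC) (i : Fin t) (p' : QC)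
      (o : Option (MemOp D))
      (htrans : (pc i, o, p') ∈ S.contributor.trans) (hmem : MemStep o a a') :
      Step S ⟨q, a, pc⟩ o ⟨q, a', Function.update pc i p'⟩

/-- The initial configuration with `t` contributors. -/
def initConfig (S : LCSystem D QL QC) (t : ℕ) : Config D QL QC t :=
  ⟨S.leader.init, S.initVal, fun _ => S.contributor.init⟩

/-- `S.Computation c c'`: there is a (finite, possibly empty) computation from `c` to `c'`. -/
def Computation (S : LCSystem D QL QC) {t : ℕ} (c c' : Config D QL QC t) : Prop :=
  Relation.ReflTransGen (fun c₁ c₂ => ∃ o, S.Step c₁ o c₂) c c'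

/-- The reachability question: is there, for some number `t` of contributors, a computation from
the initial configuration to a configuration in which the leader is in a final state? -/
def LeaderReaches (S : LCSystem D QL QC) (F : Set QL) : Prop :=
  ∃ (t : ℕ) (c : Config D QL QC t), S.Computation (S.initConfig t) c ∧ c.leader ∈ F

end LCSystem

/-! ## Inputs of the reachability problem -/

/-- An input of the problem LCR, written down explicitly: the data domain, the leader states and
the contributor states are `{0, …, D - 1}`, `{0, …, L - 1}` and `{0, …, C - 1}`, and the transition
relations and the set of final states are given by lists of their elements. Every leader
contributor system with finitely many data values and states has this form, up to the naming of
values and states. -/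
structure LCRInput where
  /-- the size of the data domain -/
  D : ℕ
  /-- the number of leader states -/
  L : ℕ
  /-- the number of contributor states -/
  C : ℕ
  /-- the initial memory value -/
  initVal : Fin D
  /-- the initial state of the leader -/
  initL : Fin L
  /-- the initial state of the contributor -/
  initC : Fin C
  /-- the transitions of the leader -/
  transL : List (Fin L × Option (MemOp (Fin D)) × Fin L)
  /-- the transitions of the contributor -/
  transC : List (Fin C × Option (MemOp (Fin D)) × Fin C)
  /-- the final states -/
  final : List (Fin L)

namespace LCRInput

/-- The leader contributor system described by an input. -/
def system (I : LCRInput) : LCSystem (Fin I.D) (Fin I.L) (Fin I.C) where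
  initVal := I.initVal
  leader := ⟨I.initL, {x | x ∈ I.transL}⟩
  contributor := ⟨I.initC, {x | x ∈ I.transC}⟩

/-- The input is a yes-instance of LCR. -/
def LCR (I : LCRInput) : Prop :=
  I.system.LeaderReaches {q | q ∈ I.final}

/-- The size of an input. The length of its encoding below lies between this number and a
polynomial in it. -/
def size (I : LCRInput) : ℕ :=
  I.D + I.L + I.C + I.transL.length + I.transC.length + I.final.length

end LCRInput

/-! ## The machine model

Deterministic imperative programs with finitely many variables, each of which points to a binary
tree (a LISP `cons` cell or `nil`). All instructions work on pointers and cost one unit of time: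
in one unit of time at most one new cell is created. Running times in this model and on Turing
machines are polynomially related. -/

/-- The data of the machine: unlabelled binary trees. -/
abbrev Data : Type := BinaryTree Unit

namespace Data

/-- The cell with first component `x` and second component `y`. -/
abbrev cons (x y : Data) : Data := BinaryTree.node () x y

/-- First component of a cell; `nil` for `nil`. -/
def hd : Data → Data
  | .nil => .nil
  | .node _ x _ => x

/-- Second component of a cell; `nil` for `nil`. -/
def tl : Data → Data
  | .nil => .nil
  | .node _ _ y => y

end Data

/-- Programs. Variables are named by natural numbers. -/
inductive Prog : Type where
  /-- `x := nil` -/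
  | setNil (x : ℕ) : Prog
  /-- `x := y` -/
  | copy (x y : ℕ) : Prog
  /-- `x := cons y z` -/
  | cons (x y z : ℕ) : Prog
  /-- `x := hd y` -/
  | hd (x y : ℕ) : Prog
  /-- `x := tl y` -/
  | tl (x y : ℕ) : Prog
  /-- `p; q` -/
  | seq (p q : Prog) : Prog
  /-- if `x ≠ nil` then `p` else `q` -/
  | ite (x : ℕ) (p q : Prog) : Prog
  /-- while `x ≠ nil` do `p` -/
  | loop (x : ℕ) (p : Prog) : Prog

/-- A store assigns a value to every variable. -/
abbrev Store : Type := ℕ → Data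

/-- `Runs p s s' t`: started in the store `s`, the program `p` halts in the store `s'` after
exactly `t` units of time. Every assignment and every test costs one unit of time. -/
inductive Runs : Prog → Store → Store → ℕ → Prop where
  | setNil (x : ℕ) (s : Store) : Runs (.setNil x) s (Function.update s x .nil) 1
  | copy (x y : ℕ) (s : Store) : Runs (.copy x y) s (Function.update s x (s y)) 1
  | cons (x y z : ℕ) (s : Store) :
      Runs (.cons x y z) s (Function.update s x (Data.cons (s y) (s z))) 1
  | hd (x y : ℕ) (s : Store) : Runs (.hd x y) s (Function.update s x (s y).hd) 1
  | tl (x y : ℕ) (s : Store) : Runs (.tl x y) s (Function.update s x (s y).tl) 1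
  | seq {p q : Prog} {s s' s'' : Store} {t t' : ℕ} (hp : Runs p s s' t) (hq : Runs q s' s'' t') :
      Runs (.seq p q) s s'' (t + t')
  | iteTrue {x : ℕ} {p q : Prog} {s s' : Store} {t : ℕ} (hx : s x ≠ .nil) (hp : Runs p s s' t) :
      Runs (.ite x p q) s s' (t + 1)
  | iteFalse {x : ℕ} {p q : Prog} {s s' : Store} {t : ℕ} (hx : s x = .nil) (hq : Runs q s s' t) :
      Runs (.ite x p q) s s' (t + 1)
  | loopStop {x : ℕ} {p : Prog} {s : Store} (hx : s x = .nil) : Runs (.loop x p) s s 1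
  | loopStep {x : ℕ} {p : Prog} {s s' s'' : Store} {t t' : ℕ} (hx : s x ≠ .nil)
      (hp : Runs p s s' t) (hl : Runs (.loop x p) s' s'' t') :
      Runs (.loop x p) s s'' (t + 1 + t')

/-- Programs are deterministic: the final store and the running time are unique. -/
theorem Runs.deterministic {p : Prog} {s s₁ s₂ : Store} {t₁ t₂ : ℕ}
    (h₁ : Runs p s s₁ t₁) (h₂ : Runs p s s₂ t₂) : s₁ = s₂ ∧ t₁ = t₂ := by
  induction h₁ generalizing s₂ t₂ with
  | setNil | copy | cons | hd | tl => cases h₂; exact ⟨rfl, rfl⟩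
  | seq _ _ ihp ihq =>
    cases h₂ with
    | seq hp hq =>
      obtain ⟨rfl, rfl⟩ := ihp hp
      obtain ⟨rfl, rfl⟩ := ihq hq
      exact ⟨rfl, rfl⟩
  | iteTrue hx _ ih =>
    cases h₂ with
    | iteTrue _ hp => obtain ⟨rfl, rfl⟩ := ih hp; exact ⟨rfl, rfl⟩
    | iteFalse hx' _ => exact absurd hx' hx
  | iteFalse hx _ ih =>
    cases h₂ with
    | iteTrue hx' _ => exact absurd hx hx'
    | iteFalse _ hp => obtain ⟨rfl, rfl⟩ := ih hp; exact ⟨rfl, rfl⟩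
  | loopStop hx =>
    cases h₂ with
    | loopStop _ => exact ⟨rfl, rfl⟩
    | loopStep hx' _ _ => exact absurd hx hx'
  | loopStep hx _ _ ihp ihl =>
    cases h₂ with
    | loopStop hx' => exact absurd hx' hx
    | loopStep _ hp hl =>
      obtain ⟨rfl, rfl⟩ := ihp hp
      obtain ⟨rfl, rfl⟩ := ihl hl
      exact ⟨rfl, rfl⟩

/-- The initial store on input `x`: variable `0` holds `x`, all other variables hold `nil`. -/
def Store.input (x : Data) : Store := Function.update (fun _ => BinaryTree.nil) 0 x

/-- The program `p` decides the problem `P`, whose inputs are encoded by `enc`, in time `T`: on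
every input `a` it halts after at most `T a` units of time, and variable `0` then holds
a value different from `nil` if and only if `P a` is true. -/
def Prog.DecidesInTime {α : Type} (p : Prog) (enc : α → Data) (P : α → Prop) (T : α → ℕ) : Prop :=
  ∀ a : α, ∃ (s : Store) (t : ℕ),
    Runs p (Store.input (enc a)) s t ∧ t ≤ T a ∧ (s 0 ≠ BinaryTree.nil ↔ P a)

/-! ## Encoding of inputs -/

namespace Data

/-- Lists as nested cells. -/
def ofList {α : Type} (f : α → Data) : List α → Data
  | [] => .nil
  | x :: l => cons (f x) (ofList f l)

/-- The number `n` as the list of `n` copies of `nil`. -/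
def ofNat : ℕ → Data
  | 0 => .nil
  | n + 1 => cons .nil (ofNat n)

/-- Transition labels: `ε` is `nil`, a read is a cell with first component `nil`, a write is a
cell with another first component. -/
def ofLabel {n : ℕ} : Option (MemOp (Fin n)) → Data
  | none => .nil
  | some (.read a) => cons .nil (ofNat a)
  | some (.write a) => cons (cons .nil .nil) (ofNat a)

/-- Transitions. -/
def ofTrans {n m : ℕ} (x : Fin m × Option (MemOp (Fin n)) × Fin m) : Data :=
  cons (ofNat x.1) (cons (ofLabel x.2.1) (ofNat x.2.2))

end Data

/-- The encoding of an input: the list of its nine components. -/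
def LCRInput.encode (I : LCRInput) : Data :=
  Data.ofList id
    [Data.ofNat I.D, Data.ofNat I.L, Data.ofNat I.C,
      Data.ofNat I.initVal, Data.ofNat I.initL, Data.ofNat I.initC,
      Data.ofList Data.ofTrans I.transL, Data.ofList Data.ofTrans I.transC,
      Data.ofList (fun q => Data.ofNat q) I.final]

/-!
Contributors are anonymous, so a run can be repeated with many copies of every contributor. Hence
all that matters about the contributors is the set `P` of states that can be populated by
arbitrarily many of them, and a value that some state of `P` can write (`LCSystem.Avail`) is
available as long as it is needed. A search through the system keeps a node `v`, made of a leader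
state and the memory value (or the absence of knowledge about it), and such a set `P`. A move of the
search goes to a node reachable from `v` and then adds to `P` all states that contributors can reach
while the leader cycles in the strongly connected component of the new node (`LCSystem.Sat`).
Soundness is `LCSystem.Realizable.sat`.

A number of moves linear in `L + D` is enough. While a concrete run stays in the component of the
current node, no move is needed. A move is made only if a contributor or the leader writes a value
with which the component is left. With each of these moves a potential increases that is bounded by
`2 (L + D) + 1` (`LCSystem.Stage.exists_forget`, `LCSystem.Stage.exists_write`): there is a new
available value, or a new leader state from which the current node can be reached independently of
the memory, or a component that contains nodes with unknown memory value is left for one that does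
not, which cannot happen twice without a gain of the first two kinds in between.

There are at most `L (D + 1)` choices for a move, so all searches of that length together reach
`(L + D) ^ O(L + D)` situations, each of polynomial size. The algorithm computes the list of all of
them, one move after the other. Each move is computable in time polynomial in the size of the list.
This is derived from closure properties of the functions that programs compute in polynomial time
(`PolyTime`): composition, case distinction, and folds over lists with bounded accumulators.
-/

/-! ### The abstract search space -/

namespace LCSystem

variable {D QL QC : Type}

/-- `S.Avail P c`: some contributor state in `P` has a transition that writes `c`. -/
def Avail (S : LCSystem D QL QC) (P : Set QC) (c : D) : Prop :=
  ∃ p ∈ P, ∃ p', (p, some (MemOp.write c), p') ∈ S.contributor.trans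

/-- One step between nodes `(q, x)`, where `q` is a leader state and `x` is what is known about the
memory value, `none` meaning that nothing is known. The leader moves on its own, knowledge of the
memory may be forgotten, and a contributor in one of the states of `P`, each of which is populated
by as many contributors as needed, may write a value. -/
inductive Edge (S : LCSystem D QL QC) (P : Set QC) : QL × Option D → QL × Option D → Prop where
  | eps {q q' : QL} (x : Option D) (h : (q, none, q') ∈ S.leader.trans) : Edge S P (q, x) (q', x)
  | read {q q' : QL} {a : D} (h : (q, some (MemOp.read a), q') ∈ S.leader.trans) :
      Edge S P (q, some a) (q', some a)
  | write {q q' : QL} {a : D} (x : Option D) (h : (q, some (MemOp.write a), q') ∈ S.leader.trans) :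
      Edge S P (q, x) (q', some a)
  | forget (q : QL) (x : Option D) : Edge S P (q, x) (q, none)
  | supply (q : QL) (x : Option D) {c : D} (h : S.Avail P c) : Edge S P (q, x) (q, some c)

/-- Reachability in the graph of nodes, with contributors in the states of `P`. -/
def Reach (S : LCSystem D QL QC) (P : Set QC) : QL × Option D → QL × Option D → Prop :=
  Relation.ReflTransGen (S.Edge P)

/-- `v` and `u` lie in the same strongly connected component of the graph of nodes. -/
def Loop (S : LCSystem D QL QC) (P : Set QC) (v u : QL × Option D) : Prop :=
  S.Reach P v u ∧ S.Reach P u v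

/-- No new contributor state can be populated while the leader stays in the strongly connected
component of `v`: a contributor can read or write `a` without leaving the component if and only if
the component has a node with memory value `a`. -/
structure Closed (S : LCSystem D QL QC) (v : QL × Option D) (P : Set QC) : Prop where
  eps : ∀ p ∈ P, ∀ p', (p, none, p') ∈ S.contributor.trans → p' ∈ P
  op : ∀ p ∈ P, ∀ p' a o, (o = MemOp.read a ∨ o = MemOp.write a) →
    (p, some o, p') ∈ S.contributor.trans → (∃ q, S.Loop P v (q, some a)) → p' ∈ P

/-- The least set of contributor states that contains `P` and is closed at `v`. -/
def Sat (S : LCSystem D QL QC) (v : QL × Option D) (P : Set QC) : Set QC :=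
  {p | ∀ Q, P ⊆ Q → S.Closed v Q → p ∈ Q}

variable {S : LCSystem D QL QC} {P Q : Set QC} {u v w : QL × Option D}

theorem Avail.mono (h : P ⊆ Q) {c : D} : S.Avail P c → S.Avail Q c := by
  rintro ⟨p, hp, h'⟩
  exact ⟨p, h hp, h'⟩

theorem Edge.mono (h : P ⊆ Q) (e : S.Edge P u v) : S.Edge Q u v := by
  cases e with
  | eps x h => exact .eps x h
  | read h => exact .read h
  | write x h => exact .write x h
  | forget q x => exact .forget q x
  | supply q x h' => exact .supply q x (h'.mono h)

theorem Reach.mono (h : P ⊆ Q) (r : S.Reach P u v) : S.Reach Q u v :=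
  Relation.ReflTransGen.mono (fun _ _ e => Edge.mono h e) _ _ r

theorem Reach.refl (v : QL × Option D) : S.Reach P v v := Relation.ReflTransGen.refl

theorem Reach.trans (h : S.Reach P u v) (h' : S.Reach P v w) : S.Reach P u w :=
  Relation.ReflTransGen.trans h h'

theorem Edge.reach (h : S.Edge P u v) : S.Reach P u v := Relation.ReflTransGen.single h

theorem Loop.mono (h : P ⊆ Q) (r : S.Loop P u v) : S.Loop Q u v :=
  ⟨r.1.mono h, r.2.mono h⟩

/-- Reachability depends on `P` only through the values that states in `P` can write. -/
theorem Reach.of_avail (h : ∀ c, S.Avail P c → S.Avail Q c) (r : S.Reach P u v) :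
    S.Reach Q u v := by
  refine Relation.ReflTransGen.mono (fun _ _ e => ?_) _ _ r
  cases e with
  | eps x h => exact .eps x h
  | read h => exact .read h
  | write x h => exact .write x h
  | forget q x => exact .forget q x
  | supply q x h' => exact .supply q x (h _ h')

theorem subset_sat : P ⊆ S.Sat v P := fun _ hp _ hQ _ => hQ hp

theorem sat_subset (h : P ⊆ Q) (hQ : S.Closed v Q) : S.Sat v P ⊆ Q := fun _ hp => hp Q h hQ

theorem closed_sat : S.Closed v (S.Sat v P) where
  eps p hp p' ht Q hPQ hQ := hQ.eps p (hp Q hPQ hQ) p' ht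
  op p hp p' a o ho ht := fun ⟨q, hq⟩ Q hPQ hQ =>
    hQ.op p (hp Q hPQ hQ) p' a o ho ht ⟨q, hq.mono (sat_subset hPQ hQ)⟩

theorem Closed.sat_eq (h : S.Closed v P) : S.Sat v P = P :=
  (sat_subset subset_rfl h).antisymm subset_sat

/-! ### Soundness of the search space -/

open Classical in
/-- The number of contributors in state `p`. -/
noncomputable def _root_.Config.count {t : ℕ} (c : Config D QL QC t) (p : QC) : ℕ :=
  (Finset.univ.filter fun i => c.pc i = p).card

/-- The configuration `c` matches the node `v` and has at least `m` contributors in each state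
of `P`. -/
structure Has {t : ℕ} (c : Config D QL QC t) (v : QL × Option D) (P : Set QC) (m : ℕ) : Prop where
  leader : c.leader = v.1
  mem : ∀ a ∈ v.2, c.mem = a
  count : ∀ p ∈ P, m ≤ c.count p

theorem Has.anti {t : ℕ} {c : Config D QL QC t} {m n : ℕ} (h : Has c v P n) (hmn : m ≤ n) :
    Has c v P m := ⟨h.leader, h.mem, fun p hp => hmn.trans (h.count p hp)⟩

open Classical in
/-- Performing a transition from `p` to `p' ≠ p` moves one contributor from `p` to `p'`. -/
theorem exists_contributor_step {t : ℕ} {c : Config D QL QC t} {p p' : QC} {a' : D}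
    {o : Option (MemOp D)} (ht : (p, o, p') ∈ S.contributor.trans) (hm : MemStep o c.mem a')
    (hp : 0 < c.count p) (hne : p ≠ p') :
    ∃ c' : Config D QL QC t, S.Computation c c' ∧ c'.leader = c.leader ∧ c'.mem = a' ∧
      c'.count p + 1 = c.count p ∧ c'.count p' = c.count p' + 1 ∧
      ∀ r, r ≠ p → c.count r ≤ c'.count r := by
  obtain ⟨i, hi⟩ := Finset.card_pos.1 hp
  have hi : c.pc i = p := by simpa using hi
  obtain ⟨q, a, pc⟩ := c
  simp only at hi hm
  refine ⟨⟨q, a', Function.update pc i p'⟩,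
    .single ⟨o, .contributor q a a' pc i p' o (by rwa [hi]) hm⟩, rfl, rfl, ?_, ?_, ?_⟩
  · have : (Finset.univ.filter fun j => Function.update pc i p' j = p)
        = (Finset.univ.filter fun j => pc j = p).erase i := by
      ext j
      by_cases hj : j = i
      · subst hj; simp [hne.symm]
      · simp [hj]
    simp only [Config.count]
    rw [this]
    exact Finset.card_erase_add_one (by simp [hi])
  · have : (Finset.univ.filter fun j => Function.update pc i p' j = p')
        = insert i (Finset.univ.filter fun j => pc j = p') := by
      ext j
      by_cases hj : j = i
      · subst hj; simp
      · simp [hj]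
    simp only [Config.count]
    rw [this]
    exact Finset.card_insert_of_notMem (by simp [hi, hne])
  · intro r hr
    refine Finset.card_le_card fun j => ?_
    by_cases hj : j = i
    · subst hj; simp [hi, hr.symm]
    · simp [hj]

theorem Computation.trans {t : ℕ} {c c' c'' : Config D QL QC t} (h : S.Computation c c')
    (h' : S.Computation c' c'') : S.Computation c c'' := Relation.ReflTransGen.trans h h'

/-- Following an edge costs at most one contributor in each state of `P`, and none elsewhere. -/
theorem Edge.exists_computation (e : S.Edge P u v) {t m : ℕ} {c : Config D QL QC t}
    (hc : Has c u P (m + 1)) :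
    ∃ c', S.Computation c c' ∧ Has c' v P m ∧ ∀ r ∉ P, c.count r ≤ c'.count r := by
  have hc' := hc.anti (Nat.le_add_right m 1)
  have key : ∀ (q' : QL) (o : Option (MemOp D)) (a' : D), (u.1, o, q') ∈ S.leader.trans →
      MemStep o c.mem a' → (∀ a ∈ v.2, a' = a) → q' = v.1 →
      ∃ c', S.Computation c c' ∧ Has c' v P m ∧ ∀ r ∉ P, c.count r ≤ c'.count r := by
    intro q' o a' ht hm hv hq
    refine ⟨⟨q', a', c.pc⟩, .single ⟨o, ?_⟩, ⟨hq, hv, hc'.count⟩, fun r _ => le_rfl⟩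
    have := Step.leader (S := S) u.1 q' c.mem a' c.pc o ht hm
    rw [← hc.leader] at this
    exact this
  cases e with
  | eps x h => exact key _ _ _ h (.eps _) hc.mem rfl
  | read h =>
    refine key _ _ c.mem h ?_ hc.mem rfl
    rw [hc.mem _ rfl]
    exact .read _
  | write x h => exact key _ _ _ h (.write _ _) (by simp) rfl
  | forget q x => exact ⟨c, .refl, ⟨hc.leader, by simp, hc'.count⟩, fun _ _ => le_rfl⟩
  | @supply q x b h =>
    obtain ⟨p, hp, p', ht⟩ := h
    by_cases hpp : p = p'
    · subst hpp
      obtain ⟨i, hi⟩ := Finset.card_pos.1 ((Nat.succ_pos m).trans_le (hc.count p hp))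
      have hi : c.pc i = p := by simpa using hi
      have := Step.contributor (S := S) c.leader c.mem b c.pc i p _ (by rwa [hi]) (.write _ _)
      rw [← hi, Function.update_eq_self] at this
      exact ⟨⟨c.leader, b, c.pc⟩, .single ⟨_, this⟩, ⟨hc.leader, by simp, hc'.count⟩,
        fun _ _ => le_rfl⟩
    · obtain ⟨c', h1, h2, h3, h4, -, h6⟩ := exists_contributor_step ht (.write c.mem b)
        ((Nat.succ_pos m).trans_le (hc.count p hp)) hpp
      refine ⟨c', h1, ⟨h2.trans hc.leader, by simp [h3], fun r hr => ?_⟩, fun r hr => h6 r ?_⟩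
      · by_cases hrp : r = p
        · subst hrp
          have := hc.count r hr
          omega
        · exact (hc'.count r hr).trans (h6 r hrp)
      · rintro rfl
        exact hr hp

theorem Reach.exists_computation (e : S.Reach P u v) :
    ∃ k, ∀ (t m : ℕ) (c : Config D QL QC t), Has c u P (m + k) →
    ∃ c', S.Computation c c' ∧ Has c' v P m ∧ ∀ r ∉ P, c.count r ≤ c'.count r := by
  induction e with
  | refl => exact ⟨0, fun t m c hc => ⟨c, .refl, hc, fun _ _ => le_rfl⟩⟩
  | tail _ e ih =>
    obtain ⟨k, ih⟩ := ih
    refine ⟨k + 1, fun t m c hc => ?_⟩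
    obtain ⟨c₁, h1, h2, h3⟩ := ih t (m + 1) c (hc.anti (by omega))
    obtain ⟨c₂, h4, h5, h6⟩ := e.exists_computation h2
    exact ⟨c₂, h1.trans h4, h5, fun r hr => (h3 r hr).trans (h6 r hr)⟩

/-- If an operation does not change the memory, then many contributors can perform it. -/
theorem exists_computation_many {p p' : QC} {o : Option (MemOp D)} {t : ℕ}
    {c : Config D QL QC t} (ht : (p, o, p') ∈ S.contributor.trans)
    (hm : MemStep o c.mem c.mem) (hne : p ≠ p') (n : ℕ) (hn : n ≤ c.count p) :
    ∃ c', S.Computation c c' ∧ c'.leader = c.leader ∧ c'.mem = c.mem ∧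
      c'.count p + n = c.count p ∧ n ≤ c'.count p' ∧ ∀ r, r ≠ p → c.count r ≤ c'.count r := by
  induction n with
  | zero => exact ⟨c, .refl, rfl, rfl, rfl, Nat.zero_le _, fun _ _ => le_rfl⟩
  | succ n ih =>
    obtain ⟨c₁, h1, h2, h3, h4, h5, h6⟩ := ih (by omega)
    obtain ⟨c₂, k1, k2, k3, k4, k5, k6⟩ :=
      exists_contributor_step (c := c₁) ht (h3.symm ▸ hm) (by omega) hne
    exact ⟨c₂, h1.trans k1, k2.trans h2, k3.trans h3, by omega, by omega,
      fun r hr => (h6 r hr).trans (k6 r hr)⟩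

/-- The node `v` is reachable with arbitrarily many contributors in each state of `P`. -/
def Realizable (S : LCSystem D QL QC) (v : QL × Option D) (P : Set QC) : Prop :=
  ∀ m : ℕ, ∃ (t : ℕ) (c : Config D QL QC t), S.Computation (S.initConfig t) c ∧ Has c v P m

theorem Realizable.reach (h : S.Realizable u P) (hr : S.Reach P u v) : S.Realizable v P := by
  intro m
  obtain ⟨k, hk⟩ := hr.exists_computation
  obtain ⟨t, c, hc, hc'⟩ := h (m + k)
  obtain ⟨c', h1, h2, -⟩ := hk t m c hc'
  exact ⟨t, c', hc.trans h1, h2⟩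

theorem Realizable.mono (h : S.Realizable v P) (hQ : Q ⊆ P) : S.Realizable v Q := fun m =>
  let ⟨t, c, hc, h'⟩ := h m
  ⟨t, c, hc, h'.leader, h'.mem, fun p hp => h'.count p (hQ hp)⟩

/-- Travel to a node `u` of the component of `v`, let sufficiently many contributors in `p` take
the transition to `p'` there, and travel back. Since `p'` is not in `P`, the way back does not use up
the contributors in `p'`. -/
theorem Realizable.insert_of_step (h : S.Realizable v P) {p p' : QC} {o : Option (MemOp D)}
    (hp : p ∈ P) (ht : (p, o, p') ∈ S.contributor.trans)
    (hu : S.Loop P v u) (hm : ∀ a : D, (∀ b ∈ u.2, a = b) → MemStep o a a) :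
    S.Realizable v (insert p' P) := by
  by_cases hp' : p' ∈ P
  · rwa [Set.insert_eq_of_mem hp']
  intro m
  obtain ⟨k₁, h₁⟩ := hu.1.exists_computation
  obtain ⟨k₂, h₂⟩ := hu.2.exists_computation
  obtain ⟨t, c, hc, hc'⟩ := h (((m + k₂) + m) + k₁)
  obtain ⟨c₁, e1, e2, -⟩ := h₁ _ _ c hc'
  obtain ⟨c₂, f1, f2, f3, f4, f5, f6⟩ := exists_computation_many (c := c₁) ht (hm _ e2.mem)
    (by rintro rfl; exact hp' hp) m (le_trans (by omega) (e2.count p hp))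
  have h2 : Has c₂ u P (m + k₂) := by
    refine ⟨f2.trans e2.leader, fun b hb => f3.trans (e2.mem b hb), fun r hr => ?_⟩
    by_cases hrp : r = p
    · subst hrp
      have := e2.count r hr
      omega
    · have := e2.count r hr
      have := f6 r hrp
      omega
  obtain ⟨c₃, g1, g2, g3⟩ := h₂ _ _ c₂ h2
  refine ⟨t, c₃, ((hc.trans e1).trans f1).trans g1, g2.leader, g2.mem, ?_⟩
  rintro r (rfl | hr)
  · exact f5.trans (g3 r hp')
  · exact g2.count r hr

/-- A maximal realizable set of contributor states is closed. -/
theorem Realizable.sat [Finite QC] (h : S.Realizable v P) : S.Realizable v (S.Sat v P) := by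
  obtain ⟨X, -, hX⟩ := Set.Finite.exists_le_maximal
    (s := {X : Set QC | P ⊆ X ∧ S.Realizable v X}) (Set.toFinite _) (a := P) ⟨subset_rfl, h⟩
  refine hX.prop.2.mono (sat_subset hX.prop.1 ?_)
  have key : ∀ p', S.Realizable v (insert p' X) → p' ∈ X := fun p' h' =>
    hX.le_of_ge ⟨hX.prop.1.trans (Set.subset_insert _ _), h'⟩ (Set.subset_insert _ _)
      (Set.mem_insert _ _)
  constructor
  · intro p hp p' ht
    exact key p' (hX.prop.2.insert_of_step hp ht ⟨.refl v, .refl v⟩ fun a _ => .eps a)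
  · rintro p hp p' a o ho ht ⟨q, hq⟩
    refine key p' (hX.prop.2.insert_of_step hp ht hq fun b hb => ?_)
    obtain rfl := hb a rfl
    rcases ho with rfl | rfl
    · exact .read _
    · exact .write _ _

theorem realizable_init (S : LCSystem D QL QC) :
    S.Realizable (S.leader.init, some S.initVal) {S.contributor.init} := by
  intro m
  refine ⟨m, S.initConfig m, .refl, rfl, by simp [initConfig], ?_⟩
  rintro p rfl
  simp [Config.count, initConfig]

/-- `S.Explores k v P`: after `k` moves of the search the current node is `v`, and `P` is the set of
contributor states known to be populated. A move goes to any reachable node and saturates there. -/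
inductive Explores (S : LCSystem D QL QC) : ℕ → QL × Option D → Set QC → Prop where
  | start : Explores S 0 (S.leader.init, some S.initVal)
      (S.Sat (S.leader.init, some S.initVal) {S.contributor.init})
  | step {k : ℕ} {v v' : QL × Option D} {P : Set QC} (h : Explores S k v P)
      (hr : S.Reach P v v') : Explores S (k + 1) v' (S.Sat v' P)

theorem Explores.realizable [Finite QC] {k : ℕ} (h : S.Explores k v P) : S.Realizable v P := by
  induction h with
  | start => exact (realizable_init S).sat
  | step _ hr ih => exact (ih.reach hr).sat

theorem Explores.pad {k n : ℕ} (h : S.Explores k v P) (hc : S.Closed v P) (hkn : k ≤ n) :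
    S.Explores n v P := by
  induction hkn with
  | refl => exact h
  | step _ ih => simpa only [hc.sat_eq] using ih.step (.refl v)

theorem Explores.leaderReaches [Finite QC] {k : ℕ} (h : S.Explores k v P) {F : Set QL} {q : QL}
    {x : Option D} (hr : S.Reach P v (q, x)) (hq : q ∈ F) : S.LeaderReaches F := by
  obtain ⟨t, c, hc, h'⟩ := h.realizable.reach hr 0
  exact ⟨t, c, hc, by rwa [h'.leader]⟩

/-! ### Completeness of short searches -/

open Classical in
/-- The measure that increases with every move of a goal-directed search: the number of values that
contributors can write plus the number of leader states from which `v` can be reached whatever the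
memory value, counted twice, and a bonus if the component of `v` depends on a specific memory value
everywhere. -/
noncomputable def potential (S : LCSystem D QL QC) (v : QL × Option D) (P : Set QC) : ℕ :=
  2 * ({c | S.Avail P c}.ncard + {q | S.Reach P (q, none) v}.ncard) +
    if ∃ q, S.Loop P v (q, none) then 0 else 1

theorem potential_le [Finite D] [Finite QL] (v : QL × Option D) (P : Set QC) :
    S.potential v P ≤ 2 * (Nat.card QL + Nat.card D) + 1 := by
  have h1 := Set.ncard_le_card {c | S.Avail P c}
  have h2 := Set.ncard_le_card {q | S.Reach P (q, none) v}
  unfold potential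
  split_ifs <;> omega

theorem potential_lt [Finite D] [Finite QL] (hP : P ⊆ Q) (hr : S.Reach Q v w)
    (h : (∃ c, S.Avail Q c ∧ ¬ S.Avail P c) ∨
      ∃ q, S.Reach Q (q, none) w ∧ ¬ S.Reach P (q, none) v) :
    S.potential v P < S.potential w Q := by
  have hA : {c | S.Avail P c} ⊆ {c | S.Avail Q c} := fun c => Avail.mono hP
  have hV : {q | S.Reach P (q, none) v} ⊆ {q | S.Reach Q (q, none) w} :=
    fun q hq => (hq.mono hP).trans hr
  have h1 := Set.ncard_le_ncard hA
  have h2 := Set.ncard_le_ncard hV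
  have h3 : {c | S.Avail P c}.ncard + {q | S.Reach P (q, none) v}.ncard <
      {c | S.Avail Q c}.ncard + {q | S.Reach Q (q, none) w}.ncard := by
    rcases h with ⟨c, hc, hc'⟩ | ⟨q, hq, hq'⟩
    · have := Set.ncard_lt_ncard (hA.ssubset_of_mem_notMem (a := c) hc hc')
      omega
    · have := Set.ncard_lt_ncard (hV.ssubset_of_mem_notMem (a := q) hq hq')
      omega
  unfold potential
  split_ifs <;> omega

/-- The search can be at `v` with the closed set `P`, after a number of moves bounded by the
potential. -/
def Stage (S : LCSystem D QL QC) (v : QL × Option D) (P : Set QC) : Prop :=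
  S.Closed v P ∧ ∃ k ≤ S.potential v P, S.Explores k v P

theorem Stage.step (h : S.Stage v P) (hr : S.Reach P v w)
    (hlt : S.potential v P < S.potential w (S.Sat w P)) : S.Stage w (S.Sat w P) :=
  let ⟨k, hk, he⟩ := h.2
  ⟨closed_sat, k + 1, by omega, he.step hr⟩

theorem Reach.forget {x : Option D} {q : QL} (h : S.Reach P v (q, x)) : S.Reach P v (q, none) :=
  h.trans (Edge.forget q x).reach

/-- Move to `(q, none)`, unless it lies in the component of `v` already. In the former case
`(q, none)` cannot reach `v`, so `q` is a new state from which the current node is reachable. -/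
theorem Stage.exists_forget [Finite D] [Finite QL] (h : S.Stage v P) {q : QL}
    (hr : S.Reach P v (q, none)) :
    ∃ w Q, S.Stage w Q ∧ P ⊆ Q ∧ S.Loop Q w (q, none) := by
  by_cases hq : S.Reach P (q, none) v
  · exact ⟨v, P, h, subset_rfl, hr, hq⟩
  · exact ⟨(q, none), _, h.step hr (potential_lt subset_sat (hr.mono subset_sat)
      (.inr ⟨q, .refl _, hq⟩)), subset_sat, .refl _, .refl _⟩

/-- Move along a write of the leader, unless the target lies in the component of `v` already. -/
theorem Stage.exists_write [Finite D] [Finite QL] (h : S.Stage v P) {q q' : QL} {b : D}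
    (hl : S.Loop P v (q, none)) (ht : (q, some (MemOp.write b), q') ∈ S.leader.trans) :
    ∃ w Q, S.Stage w Q ∧ P ⊆ Q ∧ S.Loop Q w (q', some b) := by
  have hr : S.Reach P v (q', some b) := hl.1.trans (Edge.write _ ht).reach
  by_cases hb : S.Reach P (q', some b) v
  · exact ⟨v, P, h, subset_rfl, hr, hb⟩
  refine ⟨(q', some b), _, h.step hr ?_, subset_sat, .refl _, .refl _⟩
  set w : QL × Option D := (q', some b)
  set Q := S.Sat w P
  have hPQ : P ⊆ Q := subset_sat
  by_cases hA : ∃ c, S.Avail Q c ∧ ¬ S.Avail P c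
  · exact potential_lt hPQ (hr.mono hPQ) (.inl hA)
  by_cases hV : ∃ q, S.Reach Q (q, none) w ∧ ¬ S.Reach P (q, none) v
  · exact potential_lt hPQ (hr.mono hPQ) (.inr hV)
  push Not at hA hV
  -- The graph is unchanged. A node `(r, none)` in the component of the target would reach `v`, so
  -- the write would not have left the component of `v`. Hence the bonus is gained.
  have hn : ¬ ∃ r, S.Loop Q w (r, none) := by
    rintro ⟨r, hr1, hr2⟩
    exact hb ((hr1.of_avail hA).trans (hV r hr2))
  have h1 := Set.ncard_le_ncard (s := {c | S.Avail P c}) (t := {c | S.Avail Q c})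
    fun c => Avail.mono hPQ
  have h2 := Set.ncard_le_ncard (s := {q | S.Reach P (q, none) v})
    (t := {q | S.Reach Q (q, none) w}) fun q hq => (Reach.mono hPQ hq).trans (hr.mono hPQ)
  unfold potential
  rw [if_pos ⟨q, hl⟩, if_neg hn]
  omega

/-- The search covers the configuration `c`: the node of `c` is reachable from the current node of
the search, the memory value occurs in its component, and the contributors are in known states. -/
def Tracked (S : LCSystem D QL QC) {t : ℕ} (c : Config D QL QC t) : Prop :=
  ∃ v P, S.Stage v P ∧ (∀ i, c.pc i ∈ P) ∧ S.Reach P v (c.leader, some c.mem) ∧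
    ∃ q, S.Loop P v (q, some c.mem)

theorem tracked_init (S : LCSystem D QL QC) (t : ℕ) : S.Tracked (S.initConfig t) :=
  ⟨(S.leader.init, some S.initVal), S.Sat _ {S.contributor.init},
    ⟨closed_sat, 0, Nat.zero_le _, .start⟩,
    fun _ => subset_sat rfl, .refl _, _, .refl _, .refl _⟩

theorem Tracked.step [Finite D] [Finite QL] {t : ℕ} {c c' : Config D QL QC t}
    {o : Option (MemOp D)} (h : S.Tracked c) (hs : S.Step c o c') : S.Tracked c' := by
  obtain ⟨v, P, hst, hpc, hr, q₁, hl⟩ := h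
  cases hs with
  | leader q q' a a' pc o ht hm =>
    cases hm with
    | eps => exact ⟨v, P, hst, hpc, hr.trans (Edge.eps _ ht).reach, q₁, hl⟩
    | read => exact ⟨v, P, hst, hpc, hr.trans (Edge.read ht).reach, q₁, hl⟩
    | write =>
      obtain ⟨v', P', hst', hP, hl'⟩ := hst.exists_forget hr.forget
      obtain ⟨w, Q, hst'', hQ, hl''⟩ := hst'.exists_write hl' ht
      exact ⟨w, Q, hst'', fun i => hQ (hP (hpc i)), hl''.1, q', hl''⟩
  | contributor q a a' pc i p' o ht hm =>
    have upd : ∀ {X : Set QC}, P ⊆ X → p' ∈ X → ∀ j, Function.update pc i p' j ∈ X := by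
      intro X hX hp' j
      by_cases hj : j = i
      · subst hj; simpa
      · simpa [hj] using hX (hpc j)
    cases hm with
    | eps => exact ⟨v, P, hst, upd subset_rfl (hst.1.eps _ (hpc i) _ ht), hr, q₁, hl⟩
    | read => exact ⟨v, P, hst, upd subset_rfl
        (hst.1.op _ (hpc i) _ _ _ (.inl rfl) ht ⟨q₁, hl⟩), hr, q₁, hl⟩
    | write =>
      obtain ⟨w, Q, hst', hP, hl'⟩ := hst.exists_forget hr.forget
      have he : S.Edge Q (q, none) (q, some a') := .supply _ _ ⟨_, hP (hpc i), p', ht⟩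
      have hl'' : S.Loop Q w (q, some a') :=
        ⟨hl'.1.trans he.reach, (Edge.forget _ _).reach.trans hl'.2⟩
      exact ⟨w, Q, hst', upd hP (hst'.1.op _ (hP (hpc i)) _ _ _ (.inr rfl) ht ⟨q, hl''⟩),
        hl''.1, q, hl''⟩

theorem Tracked.computation [Finite D] [Finite QL] {t : ℕ} {c c' : Config D QL QC t}
    (h : S.Tracked c) (hc : S.Computation c c') : S.Tracked c' := by
  induction hc with
  | refl => exact h
  | tail _ hs ih => exact ih.step hs.choose_spec

/-- If the leader can reach a final state at all, then a search with a number of moves linear in the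
number of leader states and data values finds it. -/
theorem LeaderReaches.exists_explores [Finite D] [Finite QL] {F : Set QL}
    (h : S.LeaderReaches F) {n : ℕ} (hn : 2 * (Nat.card QL + Nat.card D) + 1 ≤ n) :
    ∃ v P, S.Explores n v P ∧ ∃ q ∈ F, S.Reach P v (q, none) := by
  obtain ⟨t, c, hc, hF⟩ := h
  obtain ⟨v, P, ⟨hcl, k, hk, he⟩, -, hr, -⟩ := (tracked_init S t).computation hc
  have := S.potential_le v P
  exact ⟨v, P, he.pad hcl (by omega), _, hF, hr.forget⟩

end LCSystem

/-! ### Polynomial bounds -/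

/-- `T` is bounded by a polynomial in `B`. -/
def PolyLe {α : Type} (T B : α → ℕ) : Prop := ∃ c, ∀ a, T a ≤ (B a + 2) ^ c

namespace PolyLe

variable {α β : Type} {T U B : α → ℕ}

theorem of_le (h : ∀ a, T a ≤ U a) (hU : PolyLe U B) : PolyLe T B :=
  let ⟨c, hc⟩ := hU
  ⟨c, fun a => (h a).trans (hc a)⟩

theorem self (B : α → ℕ) : PolyLe B B := ⟨1, fun a => by simp⟩

theorem const (n : ℕ) (B : α → ℕ) : PolyLe (fun _ => n) B :=
  ⟨n, fun a => (Nat.lt_pow_self (by omega : 1 < B a + 2)).le⟩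

theorem add (hT : PolyLe T B) (hU : PolyLe U B) : PolyLe (fun a => T a + U a) B := by
  obtain ⟨c, hc⟩ := hT
  obtain ⟨d, hd⟩ := hU
  refine ⟨c + d + 1, fun a => ?_⟩
  have h1 : (B a + 2) ^ c ≤ (B a + 2) ^ (c + d) := Nat.pow_le_pow_right (by omega) (by omega)
  have h2 : (B a + 2) ^ d ≤ (B a + 2) ^ (c + d) := Nat.pow_le_pow_right (by omega) (by omega)
  calc T a + U a ≤ (B a + 2) ^ (c + d) * 2 := by linarith [hc a, hd a]
    _ ≤ _ := by rw [pow_succ]; gcongr; omega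

theorem mul (hT : PolyLe T B) (hU : PolyLe U B) : PolyLe (fun a => T a * U a) B := by
  obtain ⟨c, hc⟩ := hT
  obtain ⟨d, hd⟩ := hU
  exact ⟨c + d, fun a => by rw [pow_add]; exact Nat.mul_le_mul (hc a) (hd a)⟩

theorem pow (hT : PolyLe T B) (n : ℕ) : PolyLe (fun a => T a ^ n) B := by
  obtain ⟨c, hc⟩ := hT
  exact ⟨c * n, fun a => by rw [pow_mul]; exact Nat.pow_le_pow_left (hc a) n⟩

theorem trans (hT : PolyLe T U) (hU : PolyLe U B) : PolyLe T B := by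
  obtain ⟨c, hc⟩ := hT
  exact of_le hc ((hU.add (const 2 B)).pow c)

theorem comp {T' B' : β → ℕ} (h : PolyLe T' B') (f : α → β) :
    PolyLe (fun a => T' (f a)) (fun a => B' (f a)) :=
  let ⟨c, hc⟩ := h
  ⟨c, fun a => hc (f a)⟩

end PolyLe

/-! ### Programs -/

namespace Data

/-- The number of nodes of a tree, leaves included. -/
def size : Data → ℕ
  | .nil => 1
  | .node _ x y => size x + size y + 1

theorem size_pos (d : Data) : 0 < size d := by
  cases d <;> simp [size]

@[simp] theorem size_cons (x y : Data) : size (cons x y) = size x + size y + 1 := rfl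

@[simp] theorem size_nil : size .nil = 1 := rfl

end Data

namespace Prog

/-- All variables of a program are smaller than this number. -/
def bound : Prog → ℕ
  | .setNil x => x + 1
  | .copy x y => x + y + 1
  | .cons x y z => x + y + z + 1
  | .hd x y => x + y + 1
  | .tl x y => x + y + 1
  | .seq p q => p.bound + q.bound
  | .ite x p q => x + p.bound + q.bound
  | .loop x p => x + p.bound

/-- Started in `s`, the program halts within `T` units of time in a store satisfying `Q`. -/
def Ends (p : Prog) (s : Store) (T : ℕ) (Q : Store → Prop) : Prop :=
  ∃ s' t, Runs p s s' t ∧ t ≤ T ∧ Q s'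

end Prog

theorem Runs.eq_of_bound_le {p : Prog} {s s' : Store} {t : ℕ} (h : Runs p s s' t) {x : ℕ}
    (hx : p.bound ≤ x) : s' x = s x := by
  induction h with
  | setNil | copy | cons | hd | tl =>
    simp only [Prog.bound] at hx
    exact Function.update_of_ne (by omega) _ _
  | seq _ _ ih₁ ih₂ =>
    simp only [Prog.bound] at hx
    rw [ih₂ (by omega), ih₁ (by omega)]
  | iteTrue _ _ ih | iteFalse _ _ ih =>
    simp only [Prog.bound] at hx
    exact ih (by omega)
  | loopStop => rfl
  | loopStep _ _ _ ih₁ ih₂ =>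
    rw [ih₂ hx]
    simp only [Prog.bound] at hx
    exact ih₁ (by omega)

namespace Prog

variable {p q : Prog} {s : Store} {T U : ℕ} {Q R : Store → Prop}

theorem Ends.mono (h : p.Ends s T Q) (hT : T ≤ U) (hQ : ∀ s, Q s → R s) : p.Ends s U R :=
  let ⟨s', t, h, ht, h'⟩ := h
  ⟨s', t, h, ht.trans hT, hQ _ h'⟩

theorem Ends.frame (h : p.Ends s T Q) :
    p.Ends s T fun s' => Q s' ∧ ∀ x, p.bound ≤ x → s' x = s x :=
  let ⟨s', t, h, ht, h'⟩ := h
  ⟨s', t, h, ht, h', fun _ hx => h.eq_of_bound_le hx⟩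

theorem Ends.seq (h : p.Ends s T fun s' => q.Ends s' U Q) : (p.seq q).Ends s (T + U) Q :=
  let ⟨_, _, h, ht, s'', t', h', ht', hQ⟩ := h
  ⟨s'', _, .seq h h', by omega, hQ⟩

theorem ends_setNil {x : ℕ} (h : Q (Function.update s x .nil)) : (setNil x).Ends s 1 Q :=
  ⟨_, _, .setNil x s, le_rfl, h⟩

theorem ends_copy {x y : ℕ} (h : Q (Function.update s x (s y))) : (copy x y).Ends s 1 Q :=
  ⟨_, _, .copy x y s, le_rfl, h⟩

theorem ends_cons {x y z : ℕ} (h : Q (Function.update s x (Data.cons (s y) (s z)))) :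
    (cons x y z).Ends s 1 Q :=
  ⟨_, _, .cons x y z s, le_rfl, h⟩

theorem ends_hd {x y : ℕ} (h : Q (Function.update s x (s y).hd)) : (hd x y).Ends s 1 Q :=
  ⟨_, _, .hd x y s, le_rfl, h⟩

theorem ends_tl {x y : ℕ} (h : Q (Function.update s x (s y).tl)) : (tl x y).Ends s 1 Q :=
  ⟨_, _, .tl x y s, le_rfl, h⟩

theorem ends_ite {x : ℕ} (h₁ : s x ≠ .nil → p.Ends s T Q) (h₂ : s x = .nil → q.Ends s T Q) :
    (ite x p q).Ends s (T + 1) Q := by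
  by_cases hx : s x = .nil
  · obtain ⟨s', t, h, ht, hQ⟩ := h₂ hx
    exact ⟨s', _, .iteFalse hx h, by omega, hQ⟩
  · obtain ⟨s', t, h, ht, hQ⟩ := h₁ hx
    exact ⟨s', _, .iteTrue hx h, by omega, hQ⟩

theorem ends_loop_stop {x : ℕ} (hx : s x = .nil) (h : Q s) : (loop x p).Ends s 1 Q :=
  ⟨s, _, .loopStop hx, le_rfl, h⟩

theorem ends_loop_step {x : ℕ} (hx : s x ≠ .nil)
    (h : p.Ends s T fun s' => (loop x p).Ends s' U Q) : (loop x p).Ends s (T + 1 + U) Q :=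
  let ⟨_, _, h, ht, s'', t', h', ht', hQ⟩ := h
  ⟨s'', _, .loopStep hx h h', by omega, hQ⟩

/-- Every tree can be built by a program. -/
theorem exists_build (d : Data) : ∃ p T, ∀ s, Ends p s T fun s' => s' 0 = d := by
  induction d with
  | nil => exact ⟨setNil 0, 1, fun s => ends_setNil (by simp)⟩
  | node u x y ihx ihy =>
    obtain ⟨p, T, hp⟩ := ihx
    obtain ⟨q, U, hq⟩ := ihy
    refine ⟨seq p (seq (copy (q.bound + 1) 0) (seq q (cons 0 (q.bound + 1) 0))), _,
      fun s => ((hp s).mono le_rfl fun s₁ h₁ => Ends.seq (ends_copy (Ends.seq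
        ((hq _).frame.mono le_rfl fun s₂ h₂ => ends_cons ?_)))).seq⟩
    simp [h₂.1, h₂.2, h₁]

end Prog

/-! ### Encodings -/

/-- Types whose elements are represented by binary trees. -/
class Enc (α : Type) where
  /-- the tree that represents an element -/
  enc : α → Data

open Enc (enc)

section Instances

variable {α β : Type} [Enc α] [Enc β]

/-- The encodings agree with those of inputs: numbers are unary and lists are nested cells. -/
instance : Enc Unit := ⟨fun _ => .nil⟩
instance : Enc Bool := ⟨fun b => if b then .cons .nil .nil else .nil⟩
instance : Enc ℕ := ⟨Data.ofNat⟩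
instance : Enc (α × β) := ⟨fun a => .cons (enc a.1) (enc a.2)⟩
instance : Enc (List α) := ⟨Data.ofList enc⟩

@[simp] theorem enc_unit (u : Unit) : enc u = BinaryTree.nil := rfl
@[simp] theorem enc_true : enc true = Data.cons .nil .nil := rfl
@[simp] theorem enc_false : enc false = BinaryTree.nil := rfl
@[simp] theorem enc_zero : enc 0 = BinaryTree.nil := rfl
@[simp] theorem enc_succ (n : ℕ) : enc (n + 1) = Data.cons .nil (enc n) := rfl
@[simp] theorem enc_mk (a : α) (b : β) : enc (a, b) = Data.cons (enc a) (enc b) := rfl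
@[simp] theorem enc_nil : enc ([] : List α) = BinaryTree.nil := rfl
@[simp] theorem enc_cons (a : α) (l : List α) : enc (a :: l) = Data.cons (enc a) (enc l) := rfl

theorem enc_bool_ne_nil {b : Bool} : enc b ≠ BinaryTree.nil ↔ b = true := by
  cases b <;> simp

theorem size_enc_bool (b : Bool) : (enc b).size ≤ 3 := by
  cases b <;> simp

theorem enc_replicate (n : ℕ) : enc (List.replicate n ()) = enc n := by
  induction n with
  | zero => rfl
  | succ n ih => simp [List.replicate_succ, ih]

theorem size_enc_nat (n : ℕ) : (enc n).size = 2 * n + 1 := by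
  induction n with
  | zero => rfl
  | succ n ih => simp [ih]; ring

theorem size_enc_append (l₁ l₂ : List α) :
    (enc (l₁ ++ l₂)).size + 1 = (enc l₁).size + (enc l₂).size := by
  induction l₁ with
  | nil => simp; ring
  | cons a l ih => simp; linarith

theorem size_enc_reverse (l : List α) : (enc l.reverse).size = (enc l).size := by
  induction l with
  | nil => rfl
  | cons a l ih =>
    have := size_enc_append l.reverse [a]
    simp at this ⊢
    omega

theorem size_enc_of_mem {a : α} {l : List α} (h : a ∈ l) : (enc a).size ≤ (enc l).size := by
  induction h with
  | head => simp; omega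
  | tail _ _ ih => simp; omega

theorem size_enc_sublist {l₁ l₂ : List α} (h : l₁.Sublist l₂) :
    (enc l₁).size ≤ (enc l₂).size := by
  induction h with
  | slnil => rfl
  | cons _ _ ih => simp; omega
  | cons_cons _ _ ih => simp; omega

theorem length_le_size_enc (l : List α) : l.length ≤ (enc l).size := by
  induction l with
  | nil => simp
  | cons a l ih => simp; omega

theorem size_enc_list_le {l : List α} {m : ℕ} (h : ∀ a ∈ l, (enc a).size ≤ m) :
    (enc l).size ≤ l.length * (m + 1) + 1 := by
  induction l with
  | nil => simp
  | cons a l ih =>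
    have h1 := h a (by simp)
    have h2 := ih fun b hb => h b (by simp [hb])
    simp
    linarith

end Instances

/-! ### Polynomial time computable functions -/

section PolyTime

/-- Some program computes `f`; its running time and the size of its output are bounded by a
polynomial in `B`. -/
def CompIn {α β : Type} [Enc α] [Enc β] (B : α → ℕ) (f : α → β) : Prop :=
  PolyLe (fun a => (enc (f a)).size) B ∧ ∃ (p : Prog) (T : α → ℕ), PolyLe T B ∧
    ∀ a s, s 0 = enc a → p.Ends s (T a) fun s' => s' 0 = enc (f a)

/-- `f` is computable in polynomial time. -/
@[fun_prop]
def PolyTime {α β : Type} [Enc α] [Enc β] (f : α → β) : Prop :=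
  CompIn (fun a => (enc a).size) f

variable {α β γ δ : Type} [Enc α] [Enc β] [Enc γ] [Enc δ] {B : α → ℕ}

namespace CompIn

/-- Computability depends only on the encodings of the values. -/
theorem congr {f : α → β} {g : α → γ} (hf : CompIn B f) (h : ∀ a, enc (f a) = enc (g a)) :
    CompIn B g := by
  simpa only [CompIn, h] using hf

theorem comp {g : β → γ} {f : α → β} (hg : PolyTime g) (hf : CompIn B f) :
    CompIn B fun a => g (f a) := by
  obtain ⟨hs, p, T, hT, hp⟩ := hf
  obtain ⟨hs', q, U, hU, hq⟩ := hg
  exact ⟨(hs'.comp f).trans hs, p.seq q, _, hT.add ((hU.comp f).trans hs),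
    fun a s h => ((hp a s h).mono le_rfl fun s' h' => hq _ s' h').seq⟩

theorem const (b : β) : CompIn B fun _ => b := by
  obtain ⟨p, T, hp⟩ := Prog.exists_build (enc b)
  exact ⟨.const _ _, p, fun _ => T, .const _ _, fun _ s _ => hp s⟩

theorem prodMk {f : α → β} {g : α → γ} (hf : CompIn B f) (hg : CompIn B g) :
    CompIn B fun a => (f a, g a) := by
  obtain ⟨hs, p, T, hT, hp⟩ := hf
  obtain ⟨hs', q, U, hU, hq⟩ := hg
  refine ⟨(hs.add hs').add (.const 1 _), .seq (.copy (p.bound + q.bound + 1) 0) (.seq p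
    (.seq (.copy (p.bound + q.bound + 2) 0) (.seq (.copy 0 (p.bound + q.bound + 1))
    (.seq q (.cons 0 (p.bound + q.bound + 2) 0))))), _,
    (PolyLe.const 1 _).add (hT.add ((PolyLe.const 1 _).add ((PolyLe.const 1 _).add
      (hU.add (.const 1 _))))), fun a s h => ?_⟩
  refine .seq (Prog.ends_copy (.seq ((hp a _ (by simp [h])).frame.mono le_rfl fun s₁ h₁ =>
    .seq (Prog.ends_copy (.seq (Prog.ends_copy (.seq ((hq a _ ?_).frame.mono le_rfl
    fun s₂ h₂ => Prog.ends_cons ?_))))))))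
  · have := h₁.2 (p.bound + q.bound + 1) (by omega)
    simp [this, h]
  · have := h₂.2 (p.bound + q.bound + 2) (by omega)
    simp [this, h₁.1, h₂.1]

/-- Case distinction on whether an auxiliary value is represented by the empty tree. -/
theorem cases {g : α → β} {f₁ f₂ f : α → γ} (hg : CompIn B g) (hf₁ : CompIn B f₁)
    (hf₂ : CompIn B f₂) (h₁ : ∀ a, enc (g a) ≠ BinaryTree.nil → f a = f₁ a)
    (h₂ : ∀ a, enc (g a) = BinaryTree.nil → f a = f₂ a) : CompIn B f := by
  obtain ⟨hs, p, T, hT, hp⟩ := hg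
  obtain ⟨hs₁, q₁, U₁, hU₁, hq₁⟩ := hf₁
  obtain ⟨hs₂, q₂, U₂, hU₂, hq₂⟩ := hf₂
  refine ⟨.of_le (fun a => ?_) (hs₁.add hs₂), .seq (.copy (p.bound + 1) 0) (.seq p
    (.seq (.copy (p.bound + 2) 0) (.seq (.copy 0 (p.bound + 1)) (.ite (p.bound + 2) q₁ q₂)))), _,
    (PolyLe.const 1 _).add (hT.add ((PolyLe.const 1 _).add ((PolyLe.const 1 _).add
      ((hU₁.add hU₂).add (.const 1 _))))), fun a s h => ?_⟩
  · by_cases h : enc (g a) = BinaryTree.nil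
    · simp [h₂ a h]
    · simp [h₁ a h]
  refine .seq (Prog.ends_copy (.seq ((hp a _ (by simp [h])).frame.mono le_rfl fun s₁ h' =>
    .seq (Prog.ends_copy (.seq (Prog.ends_copy (Prog.ends_ite (fun hx => ?_) fun hx => ?_)))))))
  all_goals
    have := h'.2 (p.bound + 1) (by omega)
    simp [h'.1] at hx
  · rw [h₁ a hx]
    exact (hq₁ a _ (by simp [this, h])).mono (by omega) fun _ h => h
  · rw [h₂ a hx]
    exact (hq₂ a _ (by simp [this, h])).mono (by omega) fun _ h => h

theorem bool_ite {c : α → Bool} {f₁ f₂ : α → γ} (hc : CompIn B c) (hf₁ : CompIn B f₁)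
    (hf₂ : CompIn B f₂) : CompIn B fun a => if c a then f₁ a else f₂ a :=
  hc.cases hf₁ hf₂ (fun a h => by simp [enc_bool_ne_nil.1 h]) fun a h => by
    have : c a = false := by simpa using (enc_bool_ne_nil (b := c a)).not.1 (not_not.2 h)
    simp [this]

/-- Left folds whose intermediate results stay small. Variable `k` of the program holds the argument,
`k + 1` the rest of the list, and `k + 2` the accumulator. -/
theorem foldl {l : α → List β} {init : α → γ} {step : α → γ → β → γ} {G : α → ℕ}
    (hid : CompIn B fun a : α => a) (hl : CompIn B l) (hi : CompIn B init)
    (hs : PolyTime fun x : α × γ × β => step x.1 x.2.1 x.2.2) (hG : PolyLe G B)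
    (hb : ∀ a l₁, l₁ <+: l a → (enc (l₁.foldl (step a) (init a))).size ≤ G a) :
    CompIn B fun a => (l a).foldl (step a) (init a) := by
  obtain ⟨hz, -⟩ := hid
  obtain ⟨hlz, p, T, hT, hp⟩ := hl
  obtain ⟨-, q, U, hU, hq⟩ := hi
  obtain ⟨-, r, V, ⟨c, hV⟩, hr⟩ := hs
  refine ⟨hG.of_le fun a => hb a _ (List.prefix_refl _), ?_⟩
  set k := p.bound + q.bound + r.bound + 1 with hk
  set body : Prog := .seq (.hd (k + 3) (k + 1)) (.seq (.cons 0 (k + 2) (k + 3))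
    (.seq (.cons 0 k 0) (.seq r (.seq (.copy (k + 2) 0) (.tl (k + 1) (k + 1)))))) with hbody
  set M : α → ℕ := fun a => ((enc a).size + (G a + (enc (l a)).size + 1) + 1 + 2) ^ c with hM
  have hMB : PolyLe M B :=
    PolyLe.pow (((hz.add ((hG.add hlz).add (.const 1 _))).add (.const 1 _)).add (.const 2 _)) c
  have loop_ends : ∀ a (l₂ l₁ : List β) (s : Store), l₁ ++ l₂ = l a → s k = enc a →
      s (k + 1) = enc l₂ → s (k + 2) = enc (l₁.foldl (step a) (init a)) →
      (Prog.loop (k + 1) body).Ends s (l₂.length * (M a + 6) + 1)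
        fun s' => s' (k + 2) = enc ((l a).foldl (step a) (init a)) := by
    intro a l₂
    induction l₂ with
    | nil =>
      intro l₁ s h h0 h1 h2
      simp only [List.append_nil] at h
      exact (Prog.ends_loop_stop (by simpa using h1) (by rw [h2, h])).mono (by simp) fun _ h => h
    | cons b l₂ ih =>
      intro l₁ s h h0 h1 h2
      refine Prog.Ends.mono (T := (1 + (1 + (1 + (M a + (1 + 1))))) + 1 +
        (l₂.length * (M a + 6) + 1)) (Q := fun s' => s' (k + 2) = _) ?_ ?_ fun _ h => h
      swap
      · simp only [List.length_cons]; linarith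
      refine Prog.ends_loop_step (by simp [h1]) (.seq (Prog.ends_hd (.seq (Prog.ends_cons
        (.seq (Prog.ends_cons (.seq (((hr (a, l₁.foldl (step a) (init a), b) _ ?_).frame).mono ?_
        fun s₁ h' => .seq (Prog.ends_copy (Prog.ends_tl (ih (l₁ ++ [b]) _ ?_ ?_ ?_ ?_)))))))))))
      · simp [h0, h1, h2, Data.hd]
      · refine (hV _).trans (Nat.pow_le_pow_left ?_ c)
        have e1 := hb a l₁ ⟨_, h⟩
        have e2 : (enc b).size ≤ (enc (l a)).size := size_enc_of_mem (by simp [← h])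
        simp
        omega
      · simpa using h
      · have := h'.2 k (by omega)
        simp [this, h0]
      · have := h'.2 (k + 1) (by omega)
        simp [this, h1, Data.tl]
      · simp [h'.1]
  refine ⟨.seq (.copy k 0) (.seq p (.seq (.copy (k + 1) 0) (.seq (.copy 0 k) (.seq q
    (.seq (.copy (k + 2) 0) (.seq (.loop (k + 1) body) (.copy 0 (k + 2)))))))),
    fun a => 1 + (T a + (1 + (1 + (U a + (1 + ((enc (l a)).size * (M a + 6) + 1 + 1)))))),
    (PolyLe.const 1 _).add (hT.add ((PolyLe.const 1 _).add ((PolyLe.const 1 _).add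
      (hU.add ((PolyLe.const 1 _).add (((hlz.mul (hMB.add (.const 6 _))).add (.const 1 _)).add
      (.const 1 _))))))), fun a s h => ?_⟩
  refine .seq (Prog.ends_copy (.seq ((hp a _ (by simp [h])).frame.mono le_rfl fun s₁ h₁ =>
    .seq (Prog.ends_copy (.seq (Prog.ends_copy (.seq ((hq a _ ?_).frame.mono le_rfl
    fun s₂ h₂ => .seq (Prog.ends_copy (.seq ((loop_ends a (l a) [] _ rfl ?_ ?_ ?_).mono ?_
    fun s₃ h₃ => Prog.ends_copy ?_)))))))))))
  · have := h₁.2 k (by omega)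
    simp [this, h]
  · have e1 := h₁.2 k (by omega)
    have e2 := h₂.2 k (by omega)
    simp [e1, e2, h]
  · have e2 := h₂.2 (k + 1) (by omega)
    simp [e2, h₁.1]
  · simp [h₂.1]
  · gcongr
    exact length_le_size_enc _
  · simpa using h₃

/-- Left folds in which every step adds a polynomial amount to the size of the accumulator. -/
theorem foldl_of_add {l : α → List β} {init : α → γ} {step : α → γ → β → γ} {G : α × β → ℕ}
    (hid : CompIn B fun a : α => a) (hl : CompIn B l) (hi : CompIn B init)
    (hs : PolyTime fun x : α × γ × β => step x.1 x.2.1 x.2.2)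
    (hG : PolyLe G fun x => (enc x).size)
    (hb : ∀ a c b, (enc (step a c b)).size ≤ (enc c).size + G (a, b)) :
    CompIn B fun a => (l a).foldl (step a) (init a) := by
  obtain ⟨n, hG⟩ := hG
  have hM : PolyLe (fun a => ((enc a).size + (enc (l a)).size + 1 + 2) ^ n) B :=
    (((hid.1.add hl.1).add (.const 1 _)).add (.const 2 _)).pow n
  refine foldl hid hl hi hs (hi.1.add (hl.1.mul hM)) fun a l₁ hl₁ => ?_
  have key : ∀ (l₁ : List β) (c : γ), (∀ b ∈ l₁, b ∈ l a) →
      (enc (l₁.foldl (step a) c)).size ≤ (enc c).size + l₁.length *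
        ((enc a).size + (enc (l a)).size + 1 + 2) ^ n := by
    intro l₁
    induction l₁ with
    | nil => intro c _; simp
    | cons b l₁ ih =>
      intro c h
      have h1 := ih (step a c b) fun b hb => h b (by simp [hb])
      have h2 : G (a, b) ≤ ((enc a).size + (enc (l a)).size + 1 + 2) ^ n := by
        refine (hG _).trans (Nat.pow_le_pow_left ?_ n)
        have := size_enc_of_mem (h b (by simp))
        simp
        omega
      have h3 := hb a c b
      simp only [List.foldl_cons, List.length_cons, add_mul, one_mul]
      omega
  refine (key l₁ _ fun b hb => hl₁.subset hb).trans ?_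
  gcongr
  exact hl₁.length_le.trans (length_le_size_enc _)

end CompIn

namespace PolyTime

@[fun_prop] theorem id : PolyTime fun a : α => a :=
  ⟨.self _, .setNil 1, fun _ => 1, .const 1 _, fun _ s h => Prog.ends_setNil (by simp [h])⟩

@[fun_prop] theorem const (b : β) : PolyTime fun _ : α => b := CompIn.const b

@[fun_prop] theorem comp {g : β → γ} {f : α → β} (hg : PolyTime g) (hf : PolyTime f) :
    PolyTime fun a => g (f a) := CompIn.comp hg hf

@[fun_prop] theorem prodMk {f : α → β} {g : α → γ} (hf : PolyTime f) (hg : PolyTime g) :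
    PolyTime fun a => (f a, g a) := CompIn.prodMk hf hg

theorem fst' : PolyTime fun x : α × β => x.1 :=
  ⟨.of_le (fun x => by obtain ⟨a, b⟩ := x; simp; omega) (.self _), .hd 0 0, fun _ => 1,
    .const 1 _, fun x s h => Prog.ends_hd (by obtain ⟨a, b⟩ := x; simp [h, Data.hd])⟩

theorem snd' : PolyTime fun x : α × β => x.2 :=
  ⟨.of_le (fun x => by obtain ⟨a, b⟩ := x; simp; omega) (.self _), .tl 0 0, fun _ => 1,
    .const 1 _, fun x s h => Prog.ends_tl (by obtain ⟨a, b⟩ := x; simp [h, Data.tl])⟩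

@[fun_prop] theorem fst {f : α → β × γ} (hf : PolyTime f) : PolyTime fun a => (f a).1 :=
  fst'.comp hf

@[fun_prop] theorem snd {f : α → β × γ} (hf : PolyTime f) : PolyTime fun a => (f a).2 :=
  snd'.comp hf

@[fun_prop] theorem bool_ite {c : α → Bool} {f₁ f₂ : α → γ} (hc : PolyTime c)
    (hf₁ : PolyTime f₁) (hf₂ : PolyTime f₂) : PolyTime fun a => if c a then f₁ a else f₂ a :=
  CompIn.bool_ite hc hf₁ hf₂

@[fun_prop] theorem and {c d : α → Bool} (hc : PolyTime c) (hd : PolyTime d) :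
    PolyTime fun a => c a && d a := by
  have : (fun a => c a && d a) = fun a => if c a then d a else false := by
    funext a; cases c a <;> rfl
  rw [this]; fun_prop

@[fun_prop] theorem or {c d : α → Bool} (hc : PolyTime c) (hd : PolyTime d) :
    PolyTime fun a => c a || d a := by
  have : (fun a => c a || d a) = fun a => if c a then true else d a := by
    funext a; cases c a <;> rfl
  rw [this]; fun_prop

theorem congr {f : α → β} {g : α → γ} (hf : PolyTime f) (h : ∀ a, enc (f a) = enc (g a)) :
    PolyTime g := CompIn.congr hf h

@[fun_prop] theorem cons {f : α → β} {g : α → List β} (hf : PolyTime f) (hg : PolyTime g) :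
    PolyTime fun a => f a :: g a := (hf.prodMk hg).congr fun _ => rfl

@[fun_prop] theorem succ {f : α → ℕ} (hf : PolyTime f) : PolyTime fun a => f a + 1 :=
  (PolyTime.prodMk (PolyTime.const ()) hf).congr fun _ => rfl

@[fun_prop] theorem replicate {f : α → ℕ} (hf : PolyTime f) :
    PolyTime fun a => List.replicate (f a) () := hf.congr fun _ => (enc_replicate _).symm

theorem pred' : PolyTime fun n : ℕ => n - 1 :=
  ⟨.of_le (fun n => by simp [size_enc_nat]) (.self _), .tl 0 0, fun _ => 1, .const 1 _,
    fun n s h => Prog.ends_tl (by cases n <;> simp [h, Data.tl])⟩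

@[fun_prop] theorem pred {f : α → ℕ} (hf : PolyTime f) : PolyTime fun a => f a - 1 :=
  pred'.comp hf

theorem foldl_of_add {l : α → List β} {init : α → γ} {step : α → γ → β → γ} {G : α × β → ℕ}
    (hl : PolyTime l) (hi : PolyTime init)
    (hs : PolyTime fun x : α × γ × β => step x.1 x.2.1 x.2.2)
    (hG : PolyLe G fun x => (enc x).size)
    (hb : ∀ a c b, (enc (step a c b)).size ≤ (enc c).size + G (a, b)) :
    PolyTime fun a => (l a).foldl (step a) (init a) :=
  CompIn.foldl_of_add PolyTime.id hl hi hs hG hb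

@[fun_prop] theorem sub {f g : α → ℕ} (hf : PolyTime f) (hg : PolyTime g) :
    PolyTime fun a => f a - g a := by
  have := foldl_of_add (step := fun (_ : α) c _ => c - 1) (G := fun _ => 0) hg.replicate hf
    (by fun_prop) (.const _ _) fun a c b => by simp [size_enc_nat]
  convert this using 2 with a
  induction g a with
  | zero => rfl
  | succ n ih => rw [List.replicate_succ', List.foldl_append, ← ih]; simp; omega

@[fun_prop] theorem nat_beq {f g : α → ℕ} (hf : PolyTime f) (hg : PolyTime g) :
    PolyTime fun a => f a == g a := by
  have hz : ∀ n : ℕ, enc n = BinaryTree.nil ↔ n = 0 := fun n => by cases n <;> simp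
  have h2 : PolyTime fun a => g a - f a == 0 :=
    CompIn.cases (g := fun a => g a - f a) (f₁ := fun _ => false) (f₂ := fun _ => true)
      (hg.sub hf) (const _) (const _) (fun a h => by simpa [hz] using h) fun a h => by
        simpa [hz] using h
  refine CompIn.cases (g := fun a => f a - g a) (f₁ := fun _ => false)
    (f₂ := fun a => g a - f a == 0) (hf.sub hg) (const _) h2 (fun a h => ?_) fun a h => ?_
  · simp [hz] at h ⊢; omega
  · simp only [hz] at h
    rw [Bool.eq_iff_iff]
    simp; omega

@[fun_prop] theorem any {l : α → List β} {g : α → β → Bool} (hl : PolyTime l)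
    (hg : PolyTime fun x : α × β => g x.1 x.2) : PolyTime fun a => (l a).any (g a) := by
  have hs : PolyTime fun x : α × Bool × β => x.2.1 || g x.1 x.2.2 := by
    have := hg.comp (f := fun x : α × Bool × β => (x.1, x.2.2)) (by fun_prop)
    fun_prop
  have := foldl_of_add (init := fun _ => false) (step := fun a c b => c || g a b) (G := fun _ => 3) hl (const _) hs (.const _ _)
    fun a c b => (size_enc_bool _).trans (by omega)
  convert this using 2 with a
  have : ∀ (l : List β) (c : Bool), l.foldl (fun c b => c || g a b) c = (c || l.any (g a)) := by
    intro l
    induction l with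
    | nil => simp
    | cons b l ih => intro c; simp [ih, Bool.or_assoc]
  simp [this]

theorem reverse' : PolyTime (List.reverse : List α → List α) := by
  have := foldl_of_add (α := List α) (l := fun l => l) (init := fun _ => [])
    (step := fun (_ : List α) c b => b :: c) (G := fun x => (enc x.2).size + 1) id (const _)
    (by fun_prop) ((PolyTime.snd'.1).add (.const 1 _)) fun a c b => by simp; omega
  convert this using 2 with l
  simp

@[fun_prop] theorem reverse {f : α → List β} (hf : PolyTime f) :
    PolyTime fun a => (f a).reverse := reverse'.comp hf

@[fun_prop] theorem revAppend {f g : α → List β} (hf : PolyTime f) (hg : PolyTime g) :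
    PolyTime fun a => (f a).reverse ++ g a := by
  have := foldl_of_add (step := fun (_ : α) c b => b :: c) (G := fun x => (enc x.2).size + 1)
    hf hg (by fun_prop) ((PolyTime.snd'.1).add (.const 1 _)) fun a c b => by simp; omega
  convert this using 2 with a
  simp

@[fun_prop] theorem append {f g : α → List β} (hf : PolyTime f) (hg : PolyTime g) :
    PolyTime fun a => f a ++ g a := by
  simpa using hf.reverse.revAppend hg

@[fun_prop] theorem flatMap {l : α → List β} {g : α → β → List γ} (hl : PolyTime l)
    (hg : PolyTime fun x : α × β => g x.1 x.2) : PolyTime fun a => (l a).flatMap (g a) := by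
  have hs : PolyTime fun x : α × List γ × β => (g x.1 x.2.2).reverse ++ x.2.1 := by
    have := hg.comp (f := fun x : α × List γ × β => (x.1, x.2.2)) (by fun_prop)
    fun_prop
  have := (foldl_of_add (init := fun _ => []) (step := fun a c b => (g a b).reverse ++ c) hl (const _) hs hg.1 fun a c b => by
    have := size_enc_append (g a b).reverse c
    rw [size_enc_reverse] at this
    dsimp only
    omega).reverse
  convert this using 2 with a
  have : ∀ (l : List β) (c : List γ), l.foldl (fun c b => (g a b).reverse ++ c) c =
      (l.flatMap (g a)).reverse ++ c := by
    intro l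
    induction l with
    | nil => simp
    | cons b l ih => intro c; simp [ih]
  simp [this]

@[fun_prop] theorem map {l : α → List β} {g : α → β → γ} (hl : PolyTime l)
    (hg : PolyTime fun x : α × β => g x.1 x.2) : PolyTime fun a => (l a).map (g a) := by
  have : PolyTime fun a => (l a).flatMap fun b => [g a b] := by fun_prop
  simpa only [List.map_eq_flatMap] using this

@[fun_prop] theorem filter {l : α → List β} {g : α → β → Bool} (hl : PolyTime l)
    (hg : PolyTime fun x : α × β => g x.1 x.2) : PolyTime fun a => (l a).filter (g a) := by
  have : PolyTime fun a => (l a).flatMap fun b => if g a b then [b] else [] := by fun_prop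
  convert this using 2 with a
  induction l a with
  | nil => rfl
  | cons b l ih => cases h : g a b <;> simp [h, ih]

@[fun_prop] theorem range {f : α → ℕ} (hf : PolyTime f) : PolyTime fun a => List.range (f a) := by
  have key : ∀ l : List Unit, l.foldl (fun (c : ℕ × List ℕ) _ => (c.1 + 1, c.1 :: c.2)) (0, []) =
      (l.length, (List.range l.length).reverse) := by
    intro l
    induction l using List.reverseRecOn with
    | nil => rfl
    | append_singleton l u ih => simp [ih, List.range_succ]
  have h : PolyTime fun a => (List.replicate (f a) ()).foldl
      (fun (c : ℕ × List ℕ) _ => (c.1 + 1, c.1 :: c.2)) (0, []) := by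
    refine CompIn.foldl (step := fun (_ : α) (c : ℕ × List ℕ) _ => (c.1 + 1, c.1 :: c.2))
      (G := fun a => (enc (f a)).size + ((enc (f a)).size * ((enc (f a)).size + 1) + 1) + 1) id
      hf.replicate (const _) (by fun_prop) ((hf.1.add ((hf.1.mul (hf.1.add (.const 1 _))).add
        (.const 1 _))).add (.const 1 _)) fun a l hl => ?_
    have hlen : l.length ≤ f a := by simpa using hl.length_le
    rw [key, enc_mk, Data.size_cons, size_enc_reverse]
    have h1 : (enc (List.range l.length)).size ≤
        (List.range l.length).length * ((enc (f a)).size + 1) + 1 :=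
      size_enc_list_le fun b hb => by
        rw [List.mem_range] at hb
        simp only [size_enc_nat]
        omega
    have h2 : (List.range l.length).length * ((enc (f a)).size + 1) ≤
        (enc (f a)).size * ((enc (f a)).size + 1) := by
      gcongr
      simp only [List.length_range, size_enc_nat]
      omega
    have h3 : (enc l.length).size ≤ (enc (f a)).size := by simp only [size_enc_nat]; omega
    omega
  simpa [key] using h.snd.reverse

end PolyTime

end PolyTime

/-! ### The search algorithm on numbers -/

/-- Labels with data values in `ℕ`; the flag tells whether the operation is a write. -/
abbrev NatLabel : Type := Option (Bool × ℕ)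

namespace NatLabel

instance : Enc NatLabel := ⟨fun o => o.elim .nil enc⟩

@[simp] theorem enc_none : enc (none : NatLabel) = BinaryTree.nil := rfl
@[simp] theorem enc_some (x : Bool × ℕ) : enc (some x : NatLabel) = enc x := rfl

/-- Whether the operation is a write. -/
def isWrite (o : NatLabel) : Bool := (o.getD (false, 0)).1

/-- The data value of a label, and `0` for `ε`. -/
def value (o : NatLabel) : ℕ := (o.getD (false, 0)).2

end NatLabel

/-- Transitions with states and values in `ℕ`. -/
abbrev NatTrans : Type := ℕ × NatLabel × ℕ

/-- Inputs with states and values in `ℕ`; the components are in the order of `LCRInput.encode`. -/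
abbrev NatInput : Type :=
  ℕ × ℕ × ℕ × ℕ × ℕ × ℕ × List NatTrans × List NatTrans × List ℕ × Unit

/-- Facts about the current node `v` of the search and the set `P` of populated contributor states:
`(0, p, 0)` says that `p` is in `P`, `(1, q, x)` that the node `(q, x)` is reachable from `v`, and
`(2, q, x)` that `v` is reachable from `(q, x)`. In a node, `x = 0` stands for an unknown memory
value and `x = a + 1` for the value `a`. -/
abbrev NatFact : Type := ℕ × ℕ × ℕ

namespace NatInput

/-- The size of the data domain. -/
def numData (c : NatInput) : ℕ := c.1
/-- The number of leader states. -/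
def numLeader (c : NatInput) : ℕ := c.2.1
/-- The number of contributor states. -/
def numContributor (c : NatInput) : ℕ := c.2.2.1
/-- The initial memory value. -/
def initVal (c : NatInput) : ℕ := c.2.2.2.1
/-- The initial state of the leader. -/
def initL (c : NatInput) : ℕ := c.2.2.2.2.1
/-- The initial state of the contributor. -/
def initC (c : NatInput) : ℕ := c.2.2.2.2.2.1
/-- The transitions of the leader. -/
def transL (c : NatInput) : List NatTrans := c.2.2.2.2.2.2.1
/-- The transitions of the contributor. -/
def transC (c : NatInput) : List NatTrans := c.2.2.2.2.2.2.2.1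
/-- The final states. -/
def final (c : NatInput) : List ℕ := c.2.2.2.2.2.2.2.2.1

/-- Membership in a list of facts. -/
def hasFact (F : List NatFact) (f : NatFact) : Bool :=
  F.any fun g => f.1 == g.1 && f.2.1 == g.2.1 && f.2.2 == g.2.2

/-- All nodes `(q, x)`. -/
def nodes (c : NatInput) : List (ℕ × ℕ) :=
  (List.range c.numLeader).flatMap fun q => (List.range (c.numData + 1)).map fun x => (q, x)

/-- All facts. -/
def facts (c : NatInput) : List NatFact :=
  ((List.range c.numContributor).map fun p => (0, p, 0)) ++
    ((c.nodes.map fun u => (1, u)) ++ c.nodes.map fun u => (2, u))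

/-- The relation `LCSystem.Edge`, for the contributor states that occur in `F`. -/
def edge (c : NatInput) (F : List NatFact) (u v : ℕ × ℕ) : Bool :=
  (c.transL.any fun e => e.1 == u.1 && e.2.2 == v.1 &&
    if e.2.1.isNone then u.2 == v.2
      else v.2 == e.2.1.value + 1 && (e.2.1.isWrite || u.2 == v.2)) ||
  (u.1 == v.1 && (v.2 == 0 || c.transC.any fun e =>
    hasFact F (0, e.1, 0) && e.2.1.isWrite && v.2 == e.2.1.value + 1))

/-- Whether the fact `f` follows in one step from the facts in `F`. -/
def derive (c : NatInput) (F : List NatFact) (f : NatFact) : Bool :=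
  if f.1 == 0 then
    c.transC.any fun e => e.2.2 == f.2.1 && hasFact F (0, e.1, 0) &&
      (e.2.1.isNone || (List.range c.numLeader).any fun q =>
        hasFact F (1, q, e.2.1.value + 1) && hasFact F (2, q, e.2.1.value + 1))
  else if f.1 == 1 then c.nodes.any fun u => hasFact F (1, u) && c.edge F u f.2
  else c.nodes.any fun u => hasFact F (2, u) && c.edge F f.2 u

/-- One round of deriving new facts. -/
def round (c : NatInput) (F : List NatFact) : List NatFact :=
  c.facts.filter fun f => hasFact F f || c.derive F f

/-- All facts derivable from `F`: every round adds a fact unless nothing is left to derive, so that as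
many rounds as there are facts suffice. -/
def closure (c : NatInput) (F : List NatFact) : List NatFact :=
  c.facts.foldl (fun F _ => c.round F) F

/-- The facts known before saturation at the new current node `v`: the contributor states are kept. -/
def restart (c : NatInput) (F : List NatFact) (v : ℕ × ℕ) : List NatFact :=
  c.facts.filter fun f => if f.1 == 0 then hasFact F f else f.2.1 == v.1 && f.2.2 == v.2

/-- Move to the node `v` and saturate there; stay where `v` is not reachable. -/
def move (c : NatInput) (F : List NatFact) (v : ℕ × ℕ) : List NatFact :=
  if hasFact F (1, v) then c.closure (c.restart F v) else F

/-- All results of one move from a list of situations. -/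
def moves (c : NatInput) (W : List (List NatFact)) : List (List NatFact) :=
  W.flatMap fun F => c.nodes.map fun v => c.move F v

/-- The situation in which the search starts. -/
def start (c : NatInput) : List NatFact :=
  c.closure (c.restart [(0, c.initC, 0)] (c.initL, c.initVal + 1))

/-- The number of moves of the search, in unary. -/
def steps (c : NatInput) : List Unit :=
  (List.replicate c.numLeader () ++ List.replicate c.numData ()) ++
    (List.replicate c.numLeader () ++ List.replicate c.numData ()) ++ [()]

/-- All situations at the end of the search. -/
def explore (c : NatInput) : List (List NatFact) :=
  c.steps.foldl (fun W _ => c.moves W) [c.start]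

/-- The decision procedure. -/
def accepts (c : NatInput) : Bool :=
  c.explore.any fun F => c.final.any fun q => hasFact F (1, q, 0)

theorem mem_of_mem_foldl_round {c : NatInput} {F : List NatFact} (l : List NatFact) :
    l.foldl (fun F _ => c.round F) F = F ∨ (l.foldl (fun F _ => c.round F) F).Sublist c.facts := by
  induction l using List.reverseRecOn with
  | nil => exact .inl rfl
  | append_singleton l u ih =>
    right
    rw [List.foldl_append]
    exact List.filter_sublist

theorem closure_restart_sublist (c : NatInput) (F : List NatFact) (v : ℕ × ℕ) :
    (c.closure (c.restart F v)).Sublist c.facts := by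
  rcases mem_of_mem_foldl_round (c := c) (F := c.restart F v) c.facts with h | h
  · rw [closure, h]
    exact List.filter_sublist
  · exact h

theorem move_sublist {c : NatInput} {F : List NatFact} (hF : F.Sublist c.facts) (v : ℕ × ℕ) :
    (c.move F v).Sublist c.facts := by
  unfold move
  split_ifs
  · exact closure_restart_sublist c F v
  · exact hF

end NatInput

/-! ### Running time of the search algorithm -/

namespace PolyTime

variable {α : Type} [Enc α]

@[fun_prop] theorem isWrite {f : α → NatLabel} (hf : PolyTime f) :
    PolyTime fun a => (f a).isWrite :=
  comp (g := NatLabel.isWrite) ⟨.of_le (fun _ => size_enc_bool _) (.const 3 _), .hd 0 0,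
    fun _ => 1, .const 1 _, fun o s h => Prog.ends_hd (by
      rcases o with _ | x <;> simp [h, Data.hd, NatLabel.isWrite]
      rfl)⟩ hf

@[fun_prop] theorem value {f : α → NatLabel} (hf : PolyTime f) :
    PolyTime fun a => (f a).value :=
  comp (g := NatLabel.value) ⟨.of_le (fun o => by
      rcases o with _ | ⟨b, n⟩ <;> simp [NatLabel.value]; omega) (.self _), .tl 0 0,
    fun _ => 1, .const 1 _, fun o s h => Prog.ends_tl (by
      rcases o with _ | x <;> simp [h, Data.tl, NatLabel.value]
      rfl)⟩ hf

@[fun_prop] theorem isNone {f : α → NatLabel} (hf : PolyTime f) :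
    PolyTime fun a => (f a).isNone :=
  CompIn.cases hf (const false) (const true) (fun a => by cases f a <;> simp)
    fun a => by rcases f a with _ | ⟨b, n⟩ <;> simp

variable {c : α → NatInput}

@[fun_prop] theorem numData (hc : PolyTime c) : PolyTime fun a => (c a).numData := by
  unfold NatInput.numData; fun_prop
@[fun_prop] theorem numLeader (hc : PolyTime c) : PolyTime fun a => (c a).numLeader := by
  unfold NatInput.numLeader; fun_prop
@[fun_prop] theorem numContributor (hc : PolyTime c) : PolyTime fun a => (c a).numContributor := by
  unfold NatInput.numContributor; fun_prop
@[fun_prop] theorem initVal (hc : PolyTime c) : PolyTime fun a => (c a).initVal := by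
  unfold NatInput.initVal; fun_prop
@[fun_prop] theorem initL (hc : PolyTime c) : PolyTime fun a => (c a).initL := by
  unfold NatInput.initL; fun_prop
@[fun_prop] theorem initC (hc : PolyTime c) : PolyTime fun a => (c a).initC := by
  unfold NatInput.initC; fun_prop
@[fun_prop] theorem transL (hc : PolyTime c) : PolyTime fun a => (c a).transL := by
  unfold NatInput.transL; fun_prop
@[fun_prop] theorem transC (hc : PolyTime c) : PolyTime fun a => (c a).transC := by
  unfold NatInput.transC; fun_prop
@[fun_prop] theorem final (hc : PolyTime c) : PolyTime fun a => (c a).final := by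
  unfold NatInput.final; fun_prop

@[fun_prop] theorem nodes (hc : PolyTime c) : PolyTime fun a => (c a).nodes := by
  unfold NatInput.nodes; fun_prop
@[fun_prop] theorem facts (hc : PolyTime c) : PolyTime fun a => (c a).facts := by
  unfold NatInput.facts; fun_prop
@[fun_prop] theorem steps (hc : PolyTime c) : PolyTime fun a => (c a).steps := by
  unfold NatInput.steps; fun_prop

variable {F : α → List NatFact} {f : α → NatFact} {u v : α → ℕ × ℕ}

@[fun_prop] theorem hasFact (hF : PolyTime F) (hf : PolyTime f) :
    PolyTime fun a => NatInput.hasFact (F a) (f a) := by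
  unfold NatInput.hasFact; fun_prop

@[fun_prop] theorem edge (hc : PolyTime c) (hF : PolyTime F) (hu : PolyTime u) (hv : PolyTime v) :
    PolyTime fun a => (c a).edge (F a) (u a) (v a) := by
  unfold NatInput.edge; fun_prop

@[fun_prop] theorem derive (hc : PolyTime c) (hF : PolyTime F) (hf : PolyTime f) :
    PolyTime fun a => (c a).derive (F a) (f a) := by
  unfold NatInput.derive; fun_prop

@[fun_prop] theorem round (hc : PolyTime c) (hF : PolyTime F) :
    PolyTime fun a => (c a).round (F a) := by
  unfold NatInput.round; fun_prop

@[fun_prop] theorem closure (hc : PolyTime c) (hF : PolyTime F) :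
    PolyTime fun a => (c a).closure (F a) := by
  refine CompIn.foldl (step := fun a (F : List NatFact) (_ : NatFact) => (c a).round F)
    id hc.facts hF (by fun_prop) (hF.1.add hc.facts.1) fun a l _ => ?_
  rcases NatInput.mem_of_mem_foldl_round (c := c a) (F := F a) l with h | h
  · rw [h]; omega
  · exact (size_enc_sublist h).trans (Nat.le_add_left _ _)

@[fun_prop] theorem restart (hc : PolyTime c) (hF : PolyTime F) (hv : PolyTime v) :
    PolyTime fun a => (c a).restart (F a) (v a) := by
  unfold NatInput.restart; fun_prop

@[fun_prop] theorem start (hc : PolyTime c) : PolyTime fun a => (c a).start := by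
  unfold NatInput.start; fun_prop

@[fun_prop] theorem move (hc : PolyTime c) (hF : PolyTime F) (hv : PolyTime v) :
    PolyTime fun a => (c a).move (F a) (v a) := by
  unfold NatInput.move; fun_prop

@[fun_prop] theorem moves {W : α → List (List NatFact)} (hc : PolyTime c) (hW : PolyTime W) :
    PolyTime fun a => (c a).moves (W a) := by
  unfold NatInput.moves; fun_prop

end PolyTime

namespace NatInput

theorem length_nodes (c : NatInput) : c.nodes.length = c.numLeader * (c.numData + 1) := by
  simp [nodes]

theorem length_steps (c : NatInput) : c.steps.length = 2 * (c.numLeader + c.numData) + 1 := by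
  simp [steps]; ring

theorem length_foldl_moves (c : NatInput) (l : List Unit) :
    (l.foldl (fun W _ => c.moves W) [c.start]).length = c.nodes.length ^ l.length := by
  induction l using List.reverseRecOn with
  | nil => rfl
  | append_singleton l u ih =>
    have h (W : List (List NatFact)) : (c.moves W).length = W.length * c.nodes.length := by
      simp [moves]
    rw [List.foldl_append, List.foldl_cons, List.foldl_nil, h, ih, List.length_append,
      List.length_singleton, pow_succ]

theorem sublist_of_mem_foldl_moves (c : NatInput) (l : List Unit) :
    ∀ F ∈ l.foldl (fun W _ => c.moves W) [c.start], F.Sublist c.facts := by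
  induction l using List.reverseRecOn with
  | nil => 
    intro F hF
    rw [List.foldl_nil, List.mem_singleton] at hF
    rw [hF]
    exact closure_restart_sublist _ _ _
  | append_singleton l u ih =>
    intro F hF
    simp only [List.foldl_append, List.foldl_cons, List.foldl_nil, moves, List.mem_flatMap,
      List.mem_map] at hF
    obtain ⟨F', hF', v, -, rfl⟩ := hF
    exact move_sublist (ih F' hF') v

/-- The bound on the total size of all situations, in which the running time is polynomial. -/
def cost (c : NatInput) : ℕ :=
  (c.numLeader * (c.numData + 1) + 1) ^ (2 * (c.numLeader + c.numData) + 1) * (enc c).size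

theorem polyLe_size_cost : PolyLe (fun c : NatInput => (enc c).size) cost :=
  .of_le (fun c => Nat.le_mul_of_pos_left _ (by positivity)) (.self _)

theorem _root_.PolyTime.compIn_cost {β : Type} [Enc β] {f : NatInput → β} (hf : PolyTime f) :
    CompIn cost f :=
  CompIn.comp hf ⟨polyLe_size_cost, PolyTime.id.2.imp fun _ ⟨T, hT, h⟩ =>
    ⟨T, hT.trans polyLe_size_cost, h⟩⟩

theorem compIn_explore : CompIn cost explore := by
  have hfacts : PolyTime facts := by fun_prop
  refine CompIn.foldl (step := fun c (W : List (List NatFact)) (_ : Unit) => c.moves W)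
    PolyTime.id.compIn_cost (PolyTime.compIn_cost (f := steps) (by fun_prop))
    (PolyTime.compIn_cost (f := fun c => [c.start]) (by fun_prop)) (by fun_prop)
    (((PolyLe.self cost).mul ((hfacts.1.trans polyLe_size_cost).add (.const 1 _))).add
      (.const 1 _)) fun c l hl => ?_
  refine (size_enc_list_le (m := (enc c.facts).size) fun F hF =>
    size_enc_sublist (sublist_of_mem_foldl_moves c l F hF)).trans ?_
  gcongr
  rw [length_foldl_moves, length_nodes]
  calc _ ≤ (c.numLeader * (c.numData + 1) + 1) ^ l.length :=
        Nat.pow_le_pow_left (Nat.le_succ _) _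
    _ ≤ (c.numLeader * (c.numData + 1) + 1) ^ (2 * (c.numLeader + c.numData) + 1) :=
        Nat.pow_le_pow_right (Nat.succ_pos _) (by simpa [length_steps] using hl.length_le)
    _ ≤ _ := Nat.le_mul_of_pos_right _ (Data.size_pos _)

theorem compIn_accepts : CompIn cost accepts := by
  have h : PolyTime fun x : NatInput × List (List NatFact) =>
    x.2.any fun F => x.1.final.any fun q => hasFact F (1, q, 0) := by fun_prop
  exact CompIn.comp (f := fun c => (c, explore c)) h (PolyTime.id.compIn_cost.prodMk compIn_explore)

end NatInput

/-! ### Correctness of the search algorithm -/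

/-- Repeatedly adding to a set, within a finite universe, the elements that are derivable from it
reaches a fixed point after as many rounds as the universe has elements. -/
theorem List.foldl_filter_fixed {α β : Type} {U : List α} {r : List α → α → Bool}
    (hr : ∀ X, ∀ x ∈ X, r X x = true) {X : List α} (hX : X.Sublist U) {l : List β}
    (hl : U.length ≤ l.length) :
    U.filter (r (l.foldl (fun X _ => U.filter (r X)) X)) =
      l.foldl (fun X _ => U.filter (r X)) X := by
  have hsub : ∀ Y : List α, Y.Sublist U → Y.Sublist (U.filter (r Y)) := fun Y hY => by
    have := hY.filter (r Y)
    rwa [List.filter_eq_self.2 (hr Y)] at this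
  have hY : ∀ l : List β, (l.foldl (fun X _ => U.filter (r X)) X).Sublist U := by
    intro l
    induction l using List.reverseRecOn with
    | nil => exact hX
    | append_singleton l u ih =>
      rw [List.foldl_append]
      exact List.filter_sublist
  have hlt : ∀ Y : List α, Y.Sublist U → U.filter (r Y) ≠ Y →
      Y.length < (U.filter (r Y)).length := fun Y hYU hne =>
    lt_of_le_of_ne (hsub Y hYU).length_le fun h => hne ((hsub Y hYU).eq_of_length h).symm
  have key : ∀ l : List β, U.filter (r (l.foldl (fun X _ => U.filter (r X)) X)) =
      l.foldl (fun X _ => U.filter (r X)) X ∨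
      l.length ≤ (l.foldl (fun X _ => U.filter (r X)) X).length := by
    intro l
    induction l using List.reverseRecOn with
    | nil => exact .inr (Nat.zero_le _)
    | append_singleton l u ih =>
      rw [List.foldl_append, List.foldl_cons, List.foldl_nil, List.length_append,
        List.length_singleton]
      by_cases h : U.filter (r (l.foldl (fun X _ => U.filter (r X)) X)) =
        l.foldl (fun X _ => U.filter (r X)) X
      · exact .inl (by rw [h, h])
      · have := hlt _ (hY l) h
        have := ih.resolve_left h
        exact .inr (by omega)
  by_contra h
  have h1 := hlt _ (hY l) h
  have h2 := (key l).resolve_left h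
  have h3 : (U.filter (r (l.foldl (fun X _ => U.filter (r X)) X))).length ≤ U.length :=
    List.length_filter_le _ _
  omega

namespace LCRInput

/-- The label with data values in `ℕ`. -/
def natLabel {n : ℕ} : Option (MemOp (Fin n)) → NatLabel
  | none => none
  | some (.read a) => some (false, a)
  | some (.write a) => some (true, a)

/-- Transitions with states and values in `ℕ`. -/
def natTrans {n m : ℕ} (x : Fin m × Option (MemOp (Fin n)) × Fin m) : NatTrans :=
  (x.1, natLabel x.2.1, x.2.2)

/-- Inputs with states and values in `ℕ`. -/
def toNat (I : LCRInput) : NatInput :=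
  (I.D, I.L, I.C, I.initVal, I.initL, I.initC, I.transL.map natTrans, I.transC.map natTrans,
    I.final.map Fin.val, ())

theorem enc_natTrans {n m : ℕ} (x : Fin m × Option (MemOp (Fin n)) × Fin m) :
    enc (natTrans x) = Data.ofTrans x := by
  obtain ⟨q, _ | a | a, q'⟩ := x <;> rfl

theorem enc_map {α β : Type} [Enc β] (f : α → β) (g : α → Data) (h : ∀ a, enc (f a) = g a)
    (l : List α) : enc (l.map f) = Data.ofList g l := by
  induction l with
  | nil => rfl
  | cons a l ih => rw [List.map_cons, enc_cons, h, ih]; rfl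

theorem enc_toNat (I : LCRInput) : enc I.toNat = I.encode := by
  -- In `encode`, the list of final states is coerced to `List ℕ` through the list monad.
  have h : (do let q ← I.final; pure (q : ℕ)) = I.final.map Fin.val := by
    rw [List.map_eq_flatMap]
    rfl
  simp only [encode, h, toNat, enc_mk, enc_map _ _ enc_natTrans]
  simp only [← enc_map (id : ℕ → ℕ) (fun q => Data.ofNat q) (fun _ => rfl), List.map_id]
  rfl

variable (I : LCRInput)

/-- The representation of nodes by pairs of numbers. -/
def natNode {L D : ℕ} (u : Fin L × Option (Fin D)) : ℕ × ℕ :=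
  (u.1, u.2.elim 0 fun a => a + 1)

theorem natNode_injective {L D : ℕ} : Function.Injective (natNode (L := L) (D := D)) := by
  rintro ⟨q, _ | a⟩ ⟨q', _ | a'⟩ h <;> simp [natNode, Fin.ext_iff] at h ⊢ <;> exact h

theorem mem_nodes {y : ℕ × ℕ} : y ∈ I.toNat.nodes ↔ ∃ u : Fin I.L × Option (Fin I.D),
    natNode u = y := by
  obtain ⟨q, x⟩ := y
  have : (q, x) ∈ I.toNat.nodes ↔ q < I.L ∧ x < I.D + 1 := by
    simp [NatInput.nodes, NatInput.numLeader, NatInput.numData, toNat]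
  rw [this]
  constructor
  · rintro ⟨hq, hx⟩
    rcases x with _ | a
    · exact ⟨(⟨q, hq⟩, none), rfl⟩
    · exact ⟨(⟨q, hq⟩, some ⟨a, by omega⟩), rfl⟩
  · rintro ⟨⟨q, _ | a⟩, h⟩ <;> simp [natNode] at h <;> omega

theorem mem_facts {f : NatFact} : f ∈ I.toNat.facts ↔ (∃ p : Fin I.C, (0, (p : ℕ), 0) = f) ∨
    (∃ u : Fin I.L × Option (Fin I.D), (1, natNode u) = f) ∨
    ∃ u : Fin I.L × Option (Fin I.D), (2, natNode u) = f := by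
  have h : ∀ p, p < I.C ↔ ∃ p' : Fin I.C, (p' : ℕ) = p := fun p =>
    ⟨fun h => ⟨⟨p, h⟩, rfl⟩, by rintro ⟨p', rfl⟩; exact p'.2⟩
  simp only [NatInput.facts, List.mem_append, List.mem_map, mem_nodes, List.mem_range]
  simp only [NatInput.numContributor, toNat, h]
  aesop

@[simp] theorem hasFact_iff {F : List NatFact} {f : NatFact} :
    NatInput.hasFact F f = true ↔ f ∈ F := by
  obtain ⟨a, b, c⟩ := f
  simp only [NatInput.hasFact, List.any_eq_true, Bool.and_eq_true, beq_iff_eq]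
  constructor
  · rintro ⟨⟨a', b', c'⟩, h, ⟨rfl, rfl⟩, rfl⟩
    exact h
  · intro h
    exact ⟨_, h, ⟨rfl, rfl⟩, rfl⟩

/-- The contributor states that occur in a list of facts. -/
def contrib (F : List NatFact) : Set (Fin I.C) := {p | (0, (p : ℕ), 0) ∈ F}

theorem edge_iff (F : List NatFact) (u v : Fin I.L × Option (Fin I.D)) :
    I.toNat.edge F (natNode u) (natNode v) = true ↔ I.system.Edge (I.contrib F) u v := by
  have hL : I.toNat.transL = I.transL.map natTrans := rfl
  have hC : I.toNat.transC = I.transC.map natTrans := rfl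
  obtain ⟨q, x⟩ := u
  obtain ⟨q', x'⟩ := v
  simp only [NatInput.edge, hL, hC, List.any_map, Bool.or_eq_true, List.any_eq_true,
    Function.comp_apply, Bool.and_eq_true, beq_iff_eq, hasFact_iff]
  constructor
  · rintro (⟨⟨r, o, r'⟩, ht, ⟨h1, h2⟩, h3⟩ | ⟨h1, h2⟩)
    · simp [natTrans, natNode, Fin.val_inj] at h1 h2
      subst h1 h2
      rcases o with _ | a | a
      · simp [natTrans, natLabel] at h3
        obtain rfl : x = x' := by
          have := @natNode_injective I.L I.D (r, x) (r, x') (by simpa [natNode] using h3)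
          simpa using this
        exact .eps _ ht
      · simp [natTrans, natLabel, NatLabel.value, NatLabel.isWrite] at h3
        obtain rfl : x' = some a := by
          have := @natNode_injective I.L I.D (r, x') (r, some a) (by simpa [natNode] using h3)
          simpa using this
        exact .write _ ht
      · simp [natTrans, natLabel, NatLabel.value, NatLabel.isWrite] at h3
        obtain rfl : x' = some a := by
          have := @natNode_injective I.L I.D (r, x') (r, some a) (by simpa [natNode] using h3.1)
          simpa using this
        obtain rfl : x = some a := by
          have := @natNode_injective I.L I.D (r, x) (r, some a) (by simpa [natNode] using h3.2.trans h3.1)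
          simpa using this
        exact .read ht
    · simp [natNode, Fin.val_inj] at h1
      subst h1
      rcases h2 with h2 | ⟨⟨p, o, p'⟩, ht, ⟨hp, hw⟩, h⟩
      · obtain rfl : x' = none := by cases x' <;> simp_all [natNode]
        exact .forget _ _
      · rcases o with _ | a | a <;>
          simp [natTrans, natLabel, NatLabel.value, NatLabel.isWrite] at hw h
        obtain rfl : x' = some a := by
          have := @natNode_injective I.L I.D (q, x') (q, some a) (by simpa [natNode] using h)
          simpa using this
        exact .supply _ _ ⟨p, hp, p', ht⟩
  · intro h
    cases h with
    | eps x h => exact .inl ⟨_, h, ⟨rfl, rfl⟩, by simp [natTrans, natLabel, natNode]⟩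
    | read h => exact .inl ⟨_, h, ⟨rfl, rfl⟩, by
        simp [natTrans, natLabel, natNode, NatLabel.value]⟩
    | write x h => exact .inl ⟨_, h, ⟨rfl, rfl⟩, by
        simp [natTrans, natLabel, natNode, NatLabel.value, NatLabel.isWrite]⟩
    | forget q x => exact .inr ⟨rfl, .inl rfl⟩
    | supply q x h =>
      obtain ⟨p, hp, p', ht⟩ := h
      exact .inr ⟨rfl, .inr ⟨_, ht, ⟨hp, rfl⟩, rfl⟩⟩

theorem derive_contrib_iff {F : List NatFact} {p' : Fin I.C} :
    I.toNat.derive F (0, (p' : ℕ), 0) = true ↔ ∃ p ∈ I.contrib F, ∃ o,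
      (p, o, p') ∈ I.system.contributor.trans ∧ (o = none ∨ ∃ (a : Fin I.D) (q : Fin I.L),
        (o = some (.read a) ∨ o = some (.write a)) ∧ (1, natNode (q, some a)) ∈ F ∧
          (2, natNode (q, some a)) ∈ F) := by
  have hC : I.toNat.transC = I.transC.map natTrans := rfl
  have hq : ∀ q, q < I.L ↔ ∃ q' : Fin I.L, (q' : ℕ) = q := fun q =>
    ⟨fun h => ⟨⟨q, h⟩, rfl⟩, by rintro ⟨q', rfl⟩; exact q'.2⟩
  have hL : I.toNat.numLeader = I.L := rfl
  simp only [NatInput.derive, beq_self_eq_true, if_true, hC, List.any_map, List.any_eq_true,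
    Function.comp_apply, Bool.and_eq_true, beq_iff_eq, hasFact_iff, Bool.or_eq_true,
    List.mem_range, hL, hq]
  constructor
  · rintro ⟨⟨p, o, p''⟩, ht, ⟨h1, h2⟩, h3⟩
    obtain rfl : p'' = p' := Fin.val_inj.1 h1
    refine ⟨p, h2, o, ht, ?_⟩
    rcases o with _ | a | a
    · exact .inl rfl
    · obtain h3 | ⟨_, ⟨q, rfl⟩, h⟩ := h3
      · simp [natTrans, natLabel] at h3
      · exact .inr ⟨a, q, .inr rfl, h⟩
    · obtain h3 | ⟨_, ⟨q, rfl⟩, h⟩ := h3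
      · simp [natTrans, natLabel] at h3
      · exact .inr ⟨a, q, .inl rfl, h⟩
  · rintro ⟨p, hp, o, ht, ho⟩
    refine ⟨_, ht, ⟨rfl, hp⟩, ?_⟩
    obtain rfl | ⟨a, q, rfl | rfl, h⟩ := ho
    · exact .inl rfl
    · exact .inr ⟨_, ⟨q, rfl⟩, h⟩
    · exact .inr ⟨_, ⟨q, rfl⟩, h⟩

theorem derive_forward_iff {F : List NatFact} {v : Fin I.L × Option (Fin I.D)} :
    I.toNat.derive F (1, natNode v) = true ↔
      ∃ u, (1, natNode u) ∈ F ∧ I.system.Edge (I.contrib F) u v := by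
  have : I.toNat.derive F (1, natNode v) = I.toNat.nodes.any fun u =>
    NatInput.hasFact F (1, u) && I.toNat.edge F u (natNode v) := rfl
  rw [this]
  simp only [List.any_eq_true, mem_nodes, Bool.and_eq_true, hasFact_iff]
  constructor
  · rintro ⟨_, ⟨u, rfl⟩, h, h'⟩
    exact ⟨u, h, (I.edge_iff F u v).1 h'⟩
  · rintro ⟨u, h, h'⟩
    exact ⟨_, ⟨u, rfl⟩, h, (I.edge_iff F u v).2 h'⟩

theorem derive_backward_iff {F : List NatFact} {v : Fin I.L × Option (Fin I.D)} :
    I.toNat.derive F (2, natNode v) = true ↔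
      ∃ u, (2, natNode u) ∈ F ∧ I.system.Edge (I.contrib F) v u := by
  have : I.toNat.derive F (2, natNode v) = I.toNat.nodes.any fun u =>
    NatInput.hasFact F (2, u) && I.toNat.edge F (natNode v) u := rfl
  rw [this]
  simp only [List.any_eq_true, mem_nodes, Bool.and_eq_true, hasFact_iff]
  constructor
  · rintro ⟨_, ⟨u, rfl⟩, h, h'⟩
    exact ⟨u, h, (I.edge_iff F v u).1 h'⟩
  · rintro ⟨u, h, h'⟩
    exact ⟨_, ⟨u, rfl⟩, h, (I.edge_iff F v u).2 h'⟩

variable {I}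

theorem mem_restart {F : List NatFact} {v : ℕ × ℕ} {f : NatFact} (hf : f ∈ I.toNat.facts) :
    f ∈ I.toNat.restart F v ↔ if f.1 = 0 then f ∈ F else f.2 = v := by
  rw [NatInput.restart, List.mem_filter, and_iff_right hf]
  by_cases h : f.1 = 0
  · simp [h]
  · simp [h, Prod.ext_iff]

theorem mem_round {F : List NatFact} {f : NatFact} (hf : f ∈ I.toNat.facts) :
    f ∈ I.toNat.round F ↔ f ∈ F ∨ I.toNat.derive F f = true := by
  rw [NatInput.round, List.mem_filter, and_iff_right hf]
  simp

variable (I) in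
/-- The list `F` of facts describes the situation `(v, P)` of the search. -/
def Represents (F : List NatFact) (v : Fin I.L × Option (Fin I.D)) (P : Set (Fin I.C)) : Prop :=
  I.contrib F = P ∧ ∀ u, (1, natNode u) ∈ F ↔ I.system.Reach P v u

theorem contrib_mem_facts (p : Fin I.C) : (0, (p : ℕ), 0) ∈ I.toNat.facts :=
  I.mem_facts.2 (.inl ⟨p, rfl⟩)

theorem forward_mem_facts (u : Fin I.L × Option (Fin I.D)) : (1, natNode u) ∈ I.toNat.facts :=
  I.mem_facts.2 (.inr (.inl ⟨u, rfl⟩))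

theorem backward_mem_facts (u : Fin I.L × Option (Fin I.D)) : (2, natNode u) ∈ I.toNat.facts :=
  I.mem_facts.2 (.inr (.inr ⟨u, rfl⟩))

/-- Only true facts are derived. -/
theorem sound_foldl_round (F : List NatFact) (v : Fin I.L × Option (Fin I.D))
    (l : List NatFact) {G : List NatFact}
    (hG : G = l.foldl (fun F _ => I.toNat.round F) (I.toNat.restart F (natNode v))) :
    I.contrib G ⊆ I.system.Sat v (I.contrib F) ∧
    (∀ u, (1, natNode u) ∈ G → I.system.Reach (I.system.Sat v (I.contrib F)) v u) ∧
    ∀ u, (2, natNode u) ∈ G → I.system.Reach (I.system.Sat v (I.contrib F)) u v := by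
  induction l using List.reverseRecOn generalizing G with
  | nil =>
    subst hG
    refine ⟨fun p hp => ?_, fun u hu => ?_, fun u hu => ?_⟩
    · rw [contrib, Set.mem_ofPred_eq, List.foldl_nil, mem_restart (contrib_mem_facts p)] at hp
      exact LCSystem.subset_sat hp
    · rw [List.foldl_nil, mem_restart (forward_mem_facts u)] at hu
      obtain rfl : u = v := natNode_injective (by simpa using hu)
      exact .refl u
    · rw [List.foldl_nil, mem_restart (backward_mem_facts u)] at hu
      obtain rfl : u = v := natNode_injective (by simpa using hu)
      exact .refl u
  | append_singleton l f ih =>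
    rw [List.foldl_append, List.foldl_cons, List.foldl_nil] at hG
    obtain ⟨h1, h2, h3⟩ := ih rfl
    set X := l.foldl (fun F _ => I.toNat.round F) (I.toNat.restart F (natNode v))
    subst hG
    refine ⟨fun p hp => ?_, fun u hu => ?_, fun u hu => ?_⟩
    · rw [contrib, Set.mem_ofPred_eq, mem_round (contrib_mem_facts p), derive_contrib_iff] at hp
      obtain hp | ⟨p₀, hp₀, o, ht, rfl | ⟨a, q, ho, hq, hq'⟩⟩ := hp
      · exact h1 hp
      · exact LCSystem.closed_sat.eps p₀ (h1 hp₀) p ht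
      · obtain ⟨o', rfl, ho'⟩ : ∃ o', o = some o' ∧ (o' = .read a ∨ o' = .write a) := by
          rcases ho with rfl | rfl
          · exact ⟨_, rfl, .inl rfl⟩
          · exact ⟨_, rfl, .inr rfl⟩
        exact LCSystem.closed_sat.op p₀ (h1 hp₀) p a o' ho' ht ⟨q, h2 _ hq, h3 _ hq'⟩
    · rw [mem_round (forward_mem_facts u), derive_forward_iff] at hu
      obtain hu | ⟨w, hw, he⟩ := hu
      · exact h2 u hu
      · exact (h2 w hw).trans (he.mono h1).reach
    · rw [mem_round (backward_mem_facts u), derive_backward_iff] at hu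
      obtain hu | ⟨w, hw, he⟩ := hu
      · exact h3 u hu
      · exact (he.mono h1).reach.trans (h3 w hw)

/-- The derived facts describe the saturation at `v`: they are true, and they are closed under the
rules that define reachability and saturation. -/
theorem represents_closure (F : List NatFact) (v : Fin I.L × Option (Fin I.D)) :
    I.Represents (I.toNat.closure (I.toNat.restart F (natNode v))) v
      (I.system.Sat v (I.contrib F)) := by
  obtain ⟨h1, h2, h3⟩ := sound_foldl_round F v I.toNat.facts rfl
  change I.contrib (I.toNat.closure (I.toNat.restart F (natNode v))) ⊆ _ at h1
  set G := I.toNat.closure (I.toNat.restart F (natNode v)) with hG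
  have hfix : I.toNat.round G = G :=
    List.foldl_filter_fixed (U := I.toNat.facts)
      (r := fun F f => NatInput.hasFact F f || I.toNat.derive F f)
      (fun X x hx => by simp [hx]) List.filter_sublist le_rfl
  have hder : ∀ {f}, f ∈ I.toNat.facts → I.toNat.derive G f = true → f ∈ G := fun hf h => by
    rw [← hfix]
    exact (mem_round hf).2 (.inr h)
  have hstart : ∀ f ∈ I.toNat.restart F (natNode v), f ∈ G := by
    have : ∀ l : List NatFact, ∀ f ∈ I.toNat.restart F (natNode v),
        f ∈ l.foldl (fun F _ => I.toNat.round F) (I.toNat.restart F (natNode v)) := by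
      intro l f hf
      induction l using List.reverseRecOn with
      | nil => exact hf
      | append_singleton l u ih =>
        rw [List.foldl_append]
        exact (mem_round (List.mem_filter.1 hf).1).2 (.inl ih)
    exact this _
  have hP : I.contrib F ⊆ I.contrib G := fun p hp =>
    hstart _ ((mem_restart (contrib_mem_facts p)).2 hp)
  have hforward : ∀ u, I.system.Reach (I.contrib G) v u → (1, natNode u) ∈ G := by
    intro u hu
    induction hu with
    | refl => exact hstart _ ((mem_restart (forward_mem_facts v)).2 (by simp))
    | tail _ he ih =>
      exact hder (forward_mem_facts _) (I.derive_forward_iff.2 ⟨_, ih, he⟩)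
  have hbackward : ∀ u, I.system.Reach (I.contrib G) u v → (2, natNode u) ∈ G := by
    intro u hu
    induction hu using Relation.ReflTransGen.head_induction_on with
    | refl => exact hstart _ ((mem_restart (backward_mem_facts v)).2 (by simp))
    | head he _ ih =>
      exact hder (backward_mem_facts _) (I.derive_backward_iff.2 ⟨_, ih, he⟩)
  have hclosed : I.system.Closed v (I.contrib G) :=
    { eps := fun p hp p' ht => hder (contrib_mem_facts p')
        (I.derive_contrib_iff.2 ⟨p, hp, none, ht, .inl rfl⟩)
      op := fun p hp p' a o ho ht ⟨q, hq⟩ => hder (contrib_mem_facts p')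
        (I.derive_contrib_iff.2 ⟨p, hp, some o, ht, .inr ⟨a, q, by simpa using ho,
          hforward _ hq.1, hbackward _ hq.2⟩⟩) }
  have heq : I.contrib G = I.system.Sat v (I.contrib F) :=
    h1.antisymm (LCSystem.sat_subset hP hclosed)
  exact ⟨heq, fun u => ⟨h2 u, fun hu => hforward u (heq ▸ hu)⟩⟩

theorem represents_start (I : LCRInput) : I.Represents I.toNat.start
    (I.initL, some I.initVal) (I.system.Sat (I.initL, some I.initVal) {I.initC}) := by
  have h : I.contrib [(0, (I.initC : ℕ), 0)] = {I.initC} := by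
    ext p
    simp [contrib, Fin.val_inj]
  rw [← h]
  exact represents_closure (I := I) _ (I.initL, some I.initVal)

theorem exists_explores_of_mem (l : List Unit) : ∀ F ∈ l.foldl (fun W _ => I.toNat.moves W)
    [I.toNat.start], ∃ k v P, I.system.Explores k v P ∧ I.Represents F v P := by
  induction l using List.reverseRecOn with
  | nil =>
    intro F hF
    rw [List.foldl_nil, List.mem_singleton] at hF
    subst hF
    exact ⟨0, _, _, .start, represents_start I⟩
  | append_singleton l u ih =>
    intro F hF
    simp only [List.foldl_append, List.foldl_cons, List.foldl_nil, NatInput.moves,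
      List.mem_flatMap, List.mem_map, mem_nodes] at hF
    obtain ⟨F', hF', _, ⟨w, rfl⟩, rfl⟩ := hF
    obtain ⟨k, v, P, he, rfl, hR⟩ := ih F' hF'
    rw [NatInput.move]
    split_ifs with h
    · exact ⟨_, _, _, he.step ((hR w).1 (hasFact_iff.1 h)), represents_closure F' w⟩
    · exact ⟨k, v, _, he, rfl, hR⟩

theorem exists_mem_of_explores {n : ℕ} {v : Fin I.L × Option (Fin I.D)} {P : Set (Fin I.C)}
    (he : I.system.Explores n v P) (l : List Unit) (hl : l.length = n) :
    ∃ F ∈ l.foldl (fun W _ => I.toNat.moves W) [I.toNat.start], I.Represents F v P := by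
  induction he generalizing l with
  | start =>
    obtain rfl := List.length_eq_zero_iff.1 hl
    exact ⟨_, List.mem_singleton_self _, represents_start I⟩
  | @step n v w P _ hr ih =>
    obtain ⟨l, u, rfl⟩ := l.eq_nil_or_concat.resolve_left (by rintro rfl; simp at hl)
    obtain ⟨F, hF, rfl, hR⟩ := ih l (by simpa using hl)
    refine ⟨I.toNat.move F (natNode w), ?_, ?_⟩
    · rw [List.concat_eq_append, List.foldl_append, List.foldl_cons, List.foldl_nil,
        NatInput.moves, List.mem_flatMap]
      exact ⟨F, hF, List.mem_map.2 ⟨_, I.mem_nodes.2 ⟨w, rfl⟩, rfl⟩⟩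
    · rw [NatInput.move, if_pos (hasFact_iff.2 ((hR w).2 hr))]
      exact represents_closure F w

theorem accepts_iff (I : LCRInput) : I.toNat.accepts = true ↔ I.LCR := by
  have hf : I.toNat.final = I.final.map Fin.val := rfl
  have hacc : I.toNat.accepts = true ↔
      ∃ F ∈ I.toNat.explore, ∃ q ∈ I.final, (1, natNode (q, (none : Option (Fin I.D)))) ∈ F := by
    simp [NatInput.accepts, hf, natNode]
  rw [hacc]
  constructor
  · rintro ⟨F, hF, q, hq, h⟩
    obtain ⟨k, v, P, he, -, hR⟩ := exists_explores_of_mem _ F hF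
    exact he.leaderReaches ((hR _).1 h) hq
  · intro h
    obtain ⟨v, P, he, q, hq, hr⟩ := LCSystem.LeaderReaches.exists_explores h
      (n := I.toNat.steps.length) (by
        rw [NatInput.length_steps, Nat.card_eq_fintype_card, Nat.card_eq_fintype_card,
          Fintype.card_fin, Fintype.card_fin]
        exact le_rfl)
    obtain ⟨F, hF, -, hR⟩ := exists_mem_of_explores he I.toNat.steps rfl
    exact ⟨F, hF, q, hq, (hR _).2 hr⟩

/-! ### The bound on the running time -/

theorem pos_sizes (I : LCRInput) : 0 < I.L ∧ 0 < I.D ∧ 0 < I.C :=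
  ⟨I.initL.pos, I.initVal.pos, I.initC.pos⟩

theorem size_enc_natTrans_le {n m N : ℕ} (hn : n ≤ N) (hm : m ≤ N)
    (x : Fin m × Option (MemOp (Fin n)) × Fin m) : (enc (natTrans x)).size ≤ 6 * N + 9 := by
  obtain ⟨q, o, q'⟩ := x
  have h1 := q.2
  have h2 := q'.2
  rcases o with _ | a | a <;> simp [natTrans, natLabel, size_enc_nat] <;> omega

theorem size_enc_toNat_le (I : LCRInput) : (enc I.toNat).size ≤ I.size ^ 6 := by
  obtain ⟨hL, hD, hC⟩ := I.pos_sizes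
  have hv := I.initVal.2
  have hl := I.initL.2
  have hc := I.initC.2
  obtain ⟨n, hn⟩ : ∃ n, n = I.size := ⟨_, rfl⟩
  have hsize := hn
  rw [size] at hsize
  have t1 := size_enc_list_le (l := I.transL.map natTrans) (m := 6 * n + 9) (by
    simp only [List.mem_map]
    rintro _ ⟨x, -, rfl⟩
    exact size_enc_natTrans_le (by omega) (by omega) x)
  have t2 := size_enc_list_le (l := I.transC.map natTrans) (m := 6 * n + 9) (by
    simp only [List.mem_map]
    rintro _ ⟨x, -, rfl⟩
    exact size_enc_natTrans_le (by omega) (by omega) x)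
  have t3 := size_enc_list_le (l := I.final.map Fin.val) (m := 2 * n + 1) (by
    simp only [List.mem_map]
    rintro _ ⟨x, -, rfl⟩
    have := x.2
    rw [size_enc_nat]
    omega)
  rw [List.length_map] at t1 t2 t3
  have m1 : I.transL.length * (6 * n + 9 + 1) ≤ n * (6 * n + 9 + 1) := by gcongr; omega
  have m2 : I.transC.length * (6 * n + 9 + 1) ≤ n * (6 * n + 9 + 1) := by gcongr; omega
  have m3 : I.final.length * (2 * n + 1 + 1) ≤ n * (2 * n + 1 + 1) := by gcongr; omega
  have hn3 : 3 ≤ n := by omega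
  rw [← hn]
  have h4 : 81 ≤ n ^ 4 := by simpa using Nat.pow_le_pow_left hn3 4
  have h6 : 81 * n ^ 2 ≤ n ^ 6 := by
    calc 81 * n ^ 2 ≤ n ^ 4 * n ^ 2 := by gcongr
      _ = n ^ 6 := by ring
  refine le_trans ?_ h6
  simp only [toNat, enc_mk, Data.size_cons, size_enc_nat, enc_unit, Data.size_nil]
  have hb : 2 * I.D + 2 * I.L + 2 * I.C + 2 * (I.initVal : ℕ) + 2 * (I.initL : ℕ) +
    2 * (I.initC : ℕ) ≤ 12 * n := by omega
  nlinarith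

theorem cost_toNat_le : ∃ c k : ℕ, ∀ I : LCRInput,
    I.toNat.cost + 2 ≤ (I.L + I.D) ^ (c * (I.L + I.D)) * I.size ^ k := by
  refine ⟨5, 7, fun I => ?_⟩
  obtain ⟨hL, hD, hC⟩ := I.pos_sizes
  have hn : 3 ≤ I.size := by rw [size]; omega
  have hbase : I.L * (I.D + 1) + 1 ≤ (I.L + I.D) ^ 2 := by nlinarith
  have hpow : (I.L * (I.D + 1) + 1) ^ (2 * (I.L + I.D) + 1) ≤ (I.L + I.D) ^ (5 * (I.L + I.D)) :=
    calc _ ≤ ((I.L + I.D) ^ 2) ^ (2 * (I.L + I.D) + 1) := Nat.pow_le_pow_left hbase _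
      _ = (I.L + I.D) ^ (2 * (2 * (I.L + I.D) + 1)) := (pow_mul _ _ _).symm
      _ ≤ _ := Nat.pow_le_pow_right (by omega) (by omega)
  have hpos : 1 ≤ (I.L + I.D) ^ (5 * (I.L + I.D)) * I.size ^ 6 :=
    Nat.mul_pos (Nat.pow_pos (by omega)) (Nat.pow_pos (by omega))
  have hcost : I.toNat.cost ≤ (I.L + I.D) ^ (5 * (I.L + I.D)) * I.size ^ 6 :=
    Nat.mul_le_mul hpow I.size_enc_toNat_le
  calc I.toNat.cost + 2 ≤ (I.L + I.D) ^ (5 * (I.L + I.D)) * I.size ^ 6 * 3 := by omega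
    _ ≤ (I.L + I.D) ^ (5 * (I.L + I.D)) * I.size ^ 6 * I.size := by gcongr
    _ = _ := by ring

end LCRInput

/-- Leader contributor reachability is decided by one program in time
`(L + D) ^ O(L + D)`, up to a factor that is polynomial in the size of the input. -/
theorem theorem3 :
    ∃ (p : Prog) (c k : ℕ),
      p.DecidesInTime LCRInput.encode LCRInput.LCR
        (fun I => (I.L + I.D) ^ (c * (I.L + I.D)) * I.size ^ k) := by
  obtain ⟨-, p, T, ⟨e, hT⟩, hp⟩ := NatInput.compIn_accepts
  obtain ⟨c, k, hc⟩ := LCRInput.cost_toNat_le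
  refine ⟨p, c * e, k * e, fun I => ?_⟩
  obtain ⟨s, t, hrun, ht, hs⟩ := hp I.toNat (Store.input I.encode)
    (by rw [LCRInput.enc_toNat]; rfl)
  refine ⟨s, t, hrun, ?_, by rw [hs, enc_bool_ne_nil, LCRInput.accepts_iff]⟩
  calc t ≤ (I.toNat.cost + 2) ^ e := ht.trans (hT _)
    _ ≤ ((I.L + I.D) ^ (c * (I.L + I.D)) * I.size ^ k) ^ e := Nat.pow_le_pow_left (hc I) e
    _ = _ := by rw [mul_pow, ← pow_mul, ← pow_mul]; congr 2; ring
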